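/- **Setting.** A normalized hypergeometric system with $\theta$-triple $(\theta_0,\theta_1,\theta_\infty)\in\mathbb{C}^3$ is a system $\frac{d}{dz}\Psi=\big(\frac{A_0}{z}+\frac{A_1}{z-1}\big)\Psi$ with $A_0,A_1\in sl_2(\mathbb{C})$, where $A_0,A_1$ have eigenvalues $\pm\theta_0/2$, $\pm\theta_1/2$ respectively, $A_0+A_1=-\frac{\theta_\infty}{2}\sigma_3$ with $\sigma_3=\mathrm{diag}(1,-1)$, $\theta_\infty\ne0$, and $A_0$ is not diagonal. Two triples are equivalent if one is obtained from the other by a permutation, changes of signs of the entries, and addition of integers $l,m,n$ to the entries with $l+m+n$ even. The system corresponds to a row $(\lambda,\mu,\nu)$ of the Schwarz list if $(\theta_\infty-1,\theta_0,\theta_1)$ is equivalent to $(\lambda,\mu,\nu)$; row 2 is $(\frac12,\frac13,\frac13)$ and row 3 is $(\frac23,\frac13,\frac13)$. An $RS$-transformation with $R$-part $R$ is a change of variable $z=R(z_1)$, $R$ a rational function, followed by a Schlesinger transformation $\Psi(R(z_1))\mapsto S(z_1)\Psi(R(z_1))$, where $S=(\det T)^{-1/2}T$ with $T$ an invertible $2\times2$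 matrix of rational functions of $z_1$. A rational function $R$ has type $R(\cdot|\cdot|\cdot)$ if the boxes list the multiplicities of the points of its fibres over $0$, $1$, $\infty$ (including the point $z_1=\infty$). **Proposition.** For $s\in\mathbb{C}$ put $p_1=73s^2+20s+1$, $p_2=37s^2+11s+1$, $p_3=47s^2+22s+2$, $$b_0=\frac{s^3(11s+2)^3p_3^3}{(4s+1)^6(10s+1)^6},\quad b_1=\frac{p_3^2(p_1^4+p_2^4)}{3^3(4s+1)^6(10s+1)^6},\quad b_2=-\frac{p_3(p_1^2+p_2^2)}{3(4s+1)^3(10s+1)^3},$$ $$c_1=\frac{(11s+2)^2p_3}{3^2(4s+1)^3(10s+1)},\quad c_2=\frac{3^2s^2p_3}{(4s+1)(10s+1)^3},\quad t=\frac{3^3s^3(11s+2)^3p_3}{(p_1-p_3)(4s+1)^3(10s+1)^3},$$ $$R_s(z_1)=-\frac{4(p_1-p_3)p_1^4p_3^4}{3^6(4s+1)^9(10s+1)^9}\,\frac{z_1(z_1-1)(z_1-t)}{(z_1-c_1)^3(z_1-c_2)^3}.$$ Suppose that none of $4s+1$, $10s+1$, $s$, $11s+2$, $s+1$, $7s+1$,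 $p_1$, $p_2$, $p_3$, $p_1-p_3$, $p_1^6-6p_1^4p_2^2+9p_1^2p_2^4-8p_2^6$ vanishes at $s$. Then: 1. $R_s$ has type $R(3+1+1+1|2+2+2|3+3)$, and $$R_s(z_1)-1=-\frac{(z_1^3+b_2z_1^2+b_1z_1+b_0)^2}{(z_1-c_1)^3(z_1-c_2)^3}.$$ 2. Let $\tilde R_s=R_s\circ M^{-1}$ with $M(z_1)=\frac{(1-t)z_1}{z_1-t}$, so that the three simple zeros $0,1,t$ of $R_s$ are moved to $0,1,\infty$. Then $\tilde R_s$ has the same type $R(3+1+1+1|2+2+2|3+3)$. 3. The transformation $RS^2_3\left(\begin{smallmatrix}1/3&1/2&1/3\\3+1+1+1&2+2+2&3+3\end{smallmatrix}\right)$ with $R$-part $\tilde R_s$ maps the hypergeometric system of row 2 to that of row 3. That is, let a normalized hypergeometric system have a $\theta$-triple obtained from $(\frac13,\frac12,\frac13)$ by changes of signs and addition of integers with even sum. Then it corresponds to row 2 of the Schwarz list, and it is mapped by $RS$-transformations with the $R$-part $\tilde R_s$ to every normalized hypergeometric system corresponding to row 3. -/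

import Mathlib

open Polynomial

noncomputable section

namespace RSTransformation

/-! Gauss hypergeometric systems in matrix form -/

/-- The Pauli matrix `diag (1, -1)`. -/
def sigma3 : Matrix (Fin 2) (Fin 2) ℂ := !![1, 0; 0, -1]

/-- The system `dΨ/dz = (A₀ / z + A₁ / (z - 1)) Ψ` is a normalized hypergeometric system with the
`θ`-triple `(θ 0, θ 1, θ 2) = (θ₀, θ₁, θ_∞)`: the eigenvalues of `A₀` and `A₁` are `± θ₀ / 2` and
`± θ₁ / 2` (so both matrices lie in `sl₂(ℂ)`), `A₀ + A₁ = - (θ_∞ / 2) σ₃`, `θ_∞ ≠ 0`, and `A₀` is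
not diagonal. -/
structure IsHypergeometric (A₀ A₁ : Matrix (Fin 2) (Fin 2) ℂ) (θ : Fin 3 → ℂ) : Prop where
  charpoly_zero : A₀.charpoly = (X - C (θ 0 / 2)) * (X + C (θ 0 / 2))
  charpoly_one : A₁.charpoly = (X - C (θ 1 / 2)) * (X + C (θ 1 / 2))
  add_eq : A₀ + A₁ = -(θ 2 / 2) • sigma3
  theta_infty_ne_zero : θ 2 ≠ 0
  not_isDiag : ¬ A₀.IsDiag

/-- `τ'` arises from `τ` by changes of signs and shifts by integers whose sum is even. -/
def ShiftEquiv (τ τ' : Fin 3 → ℂ) : Prop :=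
  ∃ (ε : Fin 3 → ℤˣ) (l : Fin 3 → ℤ), Even (∑ i, l i) ∧
    ∀ i, τ' i = (l i : ℂ) + ((ε i : ℤ) : ℂ) * τ i

/-- Equivalence of triples: permutations, changes of signs, and shifts by integers whose sum is
even. -/
def SchwarzEquiv (τ τ' : Fin 3 → ℂ) : Prop :=
  ∃ σ : Equiv.Perm (Fin 3), ShiftEquiv (fun i => τ (σ i)) τ'

/-- Row 2 of the Schwarz list, `(λ, μ, ν)`. -/
def schwarzRow2 : Fin 3 → ℂ := ![1 / 2, 1 / 3, 1 / 3]

/-- Row 3 of the Schwarz list, `(λ, μ, ν)`. -/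
def schwarzRow3 : Fin 3 → ℂ := ![2 / 3, 1 / 3, 1 / 3]

/-- The `θ`-triple `(θ₀, θ₁, θ_∞)` belongs to the given triple `(λ, μ, ν)`, where
`λ = θ_∞ - 1`, `μ = θ₀`, `ν = θ₁`, up to equivalence. -/
def CorrespondsTo (row θ : Fin 3 → ℂ) : Prop :=
  SchwarzEquiv row ![θ 2 - 1, θ 0, θ 1]

/-! Rational functions: derivative, composition, type -/

/-- The derivative of a rational function (the quotient rule). -/
def ratDeriv (f : RatFunc ℂ) : RatFunc ℂ :=
  algebraMap ℂ[X] (RatFunc ℂ) (derivative f.num * f.denom - f.num * derivative f.denom) /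
    algebraMap ℂ[X] (RatFunc ℂ) (f.denom ^ 2)

/-- The composition `f ∘ g` of rational functions. -/
def ratComp (f g : RatFunc ℂ) : RatFunc ℂ := RatFunc.eval RatFunc.C g f

/-- The degree of a rational function as a map of the Riemann sphere to itself. -/
def ratDegree (R : RatFunc ℂ) : ℕ := max R.num.natDegree R.denom.natDegree

/-- The polynomial whose roots, with their multiplicities, are the finite points of the fibre of
`R` over a point of the Riemann sphere. -/
def fibrePoly (R : RatFunc ℂ) (w : OnePoint ℂ) : ℂ[X] :=
  w.elim R.denom fun a => R.num - C a * R.denom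

/-- The multiplicities of the points of the fibre of `R` over `w`; the last summand is the
contribution of the point at infinity, if it lies in the fibre. -/
def fibreMultiplicities (R : RatFunc ℂ) (w : OnePoint ℂ) : Multiset ℕ :=
  (fibrePoly R w).roots.dedup.map (fun x => (fibrePoly R w).rootMultiplicity x) +
    if (fibrePoly R w).natDegree < ratDegree R then {ratDegree R - (fibrePoly R w).natDegree} else 0

/-- `R` has the type `R(m₀ | m₁ | m_∞)`: the multiplicities over `0`, `1`, `∞` are as given. -/
def HasType (R : RatFunc ℂ) (m₀ m₁ mInfty : Multiset ℕ) : Prop :=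
  fibreMultiplicities R ((0 : ℂ) : OnePoint ℂ) = m₀ ∧
  fibreMultiplicities R ((1 : ℂ) : OnePoint ℂ) = m₁ ∧
  fibreMultiplicities R OnePoint.infty = mInfty

/-! `RS`-transformations -/

/-- A constant matrix, viewed as a matrix of rational functions. -/
def constMat (A : Matrix (Fin 2) (Fin 2) ℂ) : Matrix (Fin 2) (Fin 2) (RatFunc ℂ) :=
  A.map RatFunc.C

/-- The coefficient matrix `A₀ / z + A₁ / (z - 1)`. -/
def coeffMat (A₀ A₁ : Matrix (Fin 2) (Fin 2) ℂ) : Matrix (Fin 2) (Fin 2) (RatFunc ℂ) :=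
  (RatFunc.X : RatFunc ℂ)⁻¹ • constMat A₀ + (RatFunc.X - 1 : RatFunc ℂ)⁻¹ • constMat A₁

/-- The `R`-part: if `dΨ/dz = A(z) Ψ`, then `Ψ(R(x))` solves the system with the coefficient
matrix `R'(x) A(R(x))`. -/
def pullback (R : RatFunc ℂ) (A : Matrix (Fin 2) (Fin 2) (RatFunc ℂ)) :
    Matrix (Fin 2) (Fin 2) (RatFunc ℂ) :=
  ratDeriv R • A.map fun f => ratComp f R

/-- The `S`-part: if `Φ' = A Φ`, then `S Φ`, where `S = (det T) ^ (-1/2) T` has determinant `1`,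
solves the system with the coefficient matrix `S' S⁻¹ + S A S⁻¹`, that is,
`T' T⁻¹ + T A T⁻¹ - (1/2) tr (T' T⁻¹)`. -/
def schlesinger (T A : Matrix (Fin 2) (Fin 2) (RatFunc ℂ)) : Matrix (Fin 2) (Fin 2) (RatFunc ℂ) :=
  T.map ratDeriv * T⁻¹ + T * A * T⁻¹ - ((T.map ratDeriv * T⁻¹).trace / 2) • 1

/-- Some `RS`-transformation with the `R`-part `R` maps the system with the coefficient matrix `A`
to the system with the coefficient matrix `B`: the change of the variable `z = R(x)` followed by a
Schlesinger transformation `S = (det T) ^ (-1/2) T` with `T` rational and `det T ≠ 0`. -/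
def RSMaps (R : RatFunc ℂ) (A B : Matrix (Fin 2) (Fin 2) (RatFunc ℂ)) : Prop :=
  ∃ T : Matrix (Fin 2) (Fin 2) (RatFunc ℂ), T.det ≠ 0 ∧ B = schlesinger T (pullback R A)

/-! The explicit one-parameter family -/

def p₁ (s : ℂ) : ℂ := 73 * s ^ 2 + 20 * s + 1

def p₂ (s : ℂ) : ℂ := 37 * s ^ 2 + 11 * s + 1

def p₃ (s : ℂ) : ℂ := 47 * s ^ 2 + 22 * s + 2

def b₀ (s : ℂ) : ℂ :=
  s ^ 3 * (11 * s + 2) ^ 3 * p₃ s ^ 3 / ((4 * s + 1) ^ 6 * (10 * s + 1) ^ 6)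

def b₁ (s : ℂ) : ℂ :=
  p₃ s ^ 2 * (p₁ s ^ 4 + p₂ s ^ 4) / (3 ^ 3 * (4 * s + 1) ^ 6 * (10 * s + 1) ^ 6)

def b₂ (s : ℂ) : ℂ :=
  -(p₃ s * (p₁ s ^ 2 + p₂ s ^ 2) / (3 * (4 * s + 1) ^ 3 * (10 * s + 1) ^ 3))

def c₁ (s : ℂ) : ℂ :=
  (11 * s + 2) ^ 2 * p₃ s / (3 ^ 2 * (4 * s + 1) ^ 3 * (10 * s + 1))

def c₂ (s : ℂ) : ℂ :=
  3 ^ 2 * s ^ 2 * p₃ s / ((4 * s + 1) * (10 * s + 1) ^ 3)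

/-- The third simple zero of the `R`-part, besides `0` and `1`. -/
def tPt (s : ℂ) : ℂ :=
  3 ^ 3 * s ^ 3 * (11 * s + 2) ^ 3 * p₃ s /
    ((p₁ s - p₃ s) * (4 * s + 1) ^ 3 * (10 * s + 1) ^ 3)

def kappa (s : ℂ) : ℂ :=
  -(4 * (p₁ s - p₃ s) * p₁ s ^ 4 * p₃ s ^ 4 / (3 ^ 6 * (4 * s + 1) ^ 9 * (10 * s + 1) ^ 9))

/-- The rational function `z = κ z₁ (z₁ - 1) (z₁ - t) / ((z₁ - c₁)³ (z₁ - c₂)³)` of `z₁`. -/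
def rPart (s : ℂ) : RatFunc ℂ :=
  RatFunc.C (kappa s) *
    (RatFunc.X * (RatFunc.X - 1) * (RatFunc.X - RatFunc.C (tPt s)) /
      ((RatFunc.X - RatFunc.C (c₁ s)) ^ 3 * (RatFunc.X - RatFunc.C (c₂ s)) ^ 3))

/-- The values of `s` for which the formulas for `rPart s` make sense and none of the points of
the fibres over `0`, `1`, `∞` coalesce. -/
def Admissible (s : ℂ) : Prop :=
  4 * s + 1 ≠ 0 ∧ 10 * s + 1 ≠ 0 ∧ s ≠ 0 ∧ 11 * s + 2 ≠ 0 ∧ s + 1 ≠ 0 ∧ 7 * s + 1 ≠ 0 ∧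
  p₁ s ≠ 0 ∧ p₂ s ≠ 0 ∧ p₃ s ≠ 0 ∧ p₁ s - p₃ s ≠ 0 ∧
  p₁ s ^ 6 - 6 * p₁ s ^ 4 * p₂ s ^ 2 + 9 * p₁ s ^ 2 * p₂ s ^ 4 - 8 * p₂ s ^ 6 ≠ 0

/-- The inverse `x ↦ t x / (x - (1 - t))` of the fractional linear transformation
`z₁ ↦ (1 - t) z₁ / (z₁ - t)`, which maps `0, 1, t` to `0, 1, ∞`. -/
def moebiusInv (t : ℂ) : RatFunc ℂ :=
  RatFunc.C t * RatFunc.X / (RatFunc.X - RatFunc.C (1 - t))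

/-- The normalized `R`-part: its three simple zeros, which are the points `0, 1, t` for
`rPart s`, are placed at `0, 1, ∞`. -/
def normalizedRPart (s : ℂ) : RatFunc ℂ := ratComp (rPart s) (moebiusInv (tPt s))

end RSTransformation

end

open RSTransformation

namespace RSTransformation

/-! Rational functions: derivation and composition -/

/-! The family depends on `s` essentially through one number `m = coverParam s`. Over the common
denominator `(4 * s + 1) * (10 * s + 1)`, the numbers `1 + m`, `1 - m`, `2 - m`, `1 - 2 * m` have
numerators `p₃`, `3 * s * (11 * s + 2)`, `p₁`, `p₁ - p₃`, and `m ^ 2 - m + 1` is the square of the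
fraction with numerator `p₂`. So the formula for `R - 1` becomes a polynomial identity in `m`, and
`normalizedRPart_eq` identifies the normalized covering with `tetrahedralCover m`. The branching
types are read off factorizations; the points of a fibre stay apart because admissibility keeps the
relevant discriminants and values nonzero.

For the statement on systems, `ProjEquiv` is gauge equivalence up to a scalar. It is an equivalence
relation, it survives nonconstant pullback (`ProjEquiv.pullback`), and between traceless systems it
yields Schlesinger transformations (`RSMaps.of_projEquiv`). Under the nonintegrality conditions of
`IrredTriple`, systems whose triples differ by signs and even shifts form a single class
(`ShiftEquiv.projEquiv`). Row 3 is the class of `(1/3, 1/3, 1/3)`, so it is enough to pull back one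
system with triple `(1/3, 1/2, 1/3)`.

That system comes from `f = ₂F₁(-1/12, 1/4; 2/3; z)`, with exponent differences `1/3, 1/2, 1/3` at
`0, 1, ∞`. At the points of multiplicity `3, 2, 3` the differences become `1`, and these points turn
regular after a scalar factor and a rational gauge. Only the three simple zeros remain singular,
each with difference `1/3`; `projEquiv_pullback_tetrahedralCover` gives the gauge explicitly. -/

theorem quotientRule_cross {S : Type*} [CommRing S] {n d p q n' d' p' q' : S}
    (h : n * q = p * d) (h' : n' * q + n * q' = p' * d + p * d') :
    (n' * d - n * d') * q ^ 2 = (p' * q - p * q') * d ^ 2 := by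
  linear_combination (d * q) * h' - (q * d' + d * q') * h

/-- The quotient rule does not depend on the chosen fraction, so derivatives can be computed without
reducing to lowest terms. -/
theorem ratDeriv_eq_of_mul_eq (f : RatFunc ℂ) (p q : ℂ[X]) (hq : q ≠ 0)
    (h : f.num * q = p * f.denom) :
    ratDeriv f = algebraMap ℂ[X] (RatFunc ℂ) (derivative p * q - p * derivative q) /
      algebraMap ℂ[X] (RatFunc ℂ) (q ^ 2) := by
  have hd : f.denom ≠ 0 := f.denom_ne_zero
  have h2 := congrArg derivative h
  simp only [derivative_mul] at h2
  rw [ratDeriv, div_eq_div_iff (RatFunc.algebraMap_ne_zero (pow_ne_zero 2 hd))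
    (RatFunc.algebraMap_ne_zero (pow_ne_zero 2 hq)), ← map_mul, ← map_mul]
  exact congrArg _ (quotientRule_cross h h2)

theorem ratDeriv_div (p q : ℂ[X]) (hq : q ≠ 0) :
    ratDeriv (algebraMap ℂ[X] (RatFunc ℂ) p / algebraMap ℂ[X] (RatFunc ℂ) q) =
      algebraMap ℂ[X] (RatFunc ℂ) (derivative p * q - p * derivative q) /
        algebraMap ℂ[X] (RatFunc ℂ) (q ^ 2) :=
  ratDeriv_eq_of_mul_eq _ p q hq ((RatFunc.num_mul_eq_mul_denom_iff hq).mpr rfl)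

theorem exists_algebraMap_div (f : RatFunc ℂ) : ∃ p q : ℂ[X], q ≠ 0 ∧
    f = algebraMap ℂ[X] (RatFunc ℂ) p / algebraMap ℂ[X] (RatFunc ℂ) q :=
  ⟨f.num, f.denom, f.denom_ne_zero, (RatFunc.num_div_denom f).symm⟩

theorem ratDeriv_add (f g : RatFunc ℂ) : ratDeriv (f + g) = ratDeriv f + ratDeriv g := by
  obtain ⟨p, q, hq, rfl⟩ := exists_algebraMap_div f
  obtain ⟨r, t, ht, rfl⟩ := exists_algebraMap_div g
  have hq' : algebraMap ℂ[X] (RatFunc ℂ) q ≠ 0 := RatFunc.algebraMap_ne_zero hq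
  have ht' : algebraMap ℂ[X] (RatFunc ℂ) t ≠ 0 := RatFunc.algebraMap_ne_zero ht
  rw [div_add_div _ _ hq' ht', ← map_mul, ← map_mul, ← map_mul, ← map_add,
    ratDeriv_div _ _ (mul_ne_zero hq ht), ratDeriv_div _ _ hq, ratDeriv_div _ _ ht]
  simp only [derivative_mul, map_add, map_sub, map_mul, map_pow]
  field_simp
  ring

theorem ratDeriv_mul (f g : RatFunc ℂ) :
    ratDeriv (f * g) = f * ratDeriv g + g * ratDeriv f := by
  obtain ⟨p, q, hq, rfl⟩ := exists_algebraMap_div f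
  obtain ⟨r, t, ht, rfl⟩ := exists_algebraMap_div g
  have hq' : algebraMap ℂ[X] (RatFunc ℂ) q ≠ 0 := RatFunc.algebraMap_ne_zero hq
  have ht' : algebraMap ℂ[X] (RatFunc ℂ) t ≠ 0 := RatFunc.algebraMap_ne_zero ht
  rw [div_mul_div_comm, ← map_mul, ← map_mul,
    ratDeriv_div _ _ (mul_ne_zero hq ht), ratDeriv_div _ _ hq, ratDeriv_div _ _ ht]
  simp only [derivative_mul, map_add, map_sub, map_mul, map_pow]
  field_simp
  ring

theorem ratDeriv_algebraMap (p : ℂ[X]) :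
    ratDeriv (algebraMap ℂ[X] (RatFunc ℂ) p) = algebraMap ℂ[X] (RatFunc ℂ) (derivative p) := by
  simpa using ratDeriv_div p 1 one_ne_zero

@[simp] theorem ratDeriv_C (a : ℂ) : ratDeriv (RatFunc.C a) = 0 := by
  simp [← RatFunc.algebraMap_C, ratDeriv_algebraMap]

@[simp] theorem ratDeriv_X : ratDeriv (RatFunc.X : RatFunc ℂ) = 1 := by
  simp [← RatFunc.algebraMap_X, ratDeriv_algebraMap]

/-- `ratDeriv` as a derivation of the field of rational functions. -/
noncomputable def ratDerivation : Derivation ℂ (RatFunc ℂ) (RatFunc ℂ) where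
  toFun := ratDeriv
  map_add' := ratDeriv_add
  map_smul' r f := by
    simp [RatFunc.smul_eq_C_mul, ratDeriv_mul]
  map_one_eq_zero' := by
    simpa using ratDeriv_C 1
  leibniz' f g := by
    simp [ratDeriv_mul]

theorem ratDerivation_apply (f : RatFunc ℂ) : ratDerivation f = ratDeriv f := rfl

@[simp] theorem ratDeriv_zero : ratDeriv (0 : RatFunc ℂ) = 0 := map_zero ratDerivation

@[simp] theorem ratDeriv_one : ratDeriv (1 : RatFunc ℂ) = 0 := by simpa using ratDeriv_C 1

@[simp] theorem ratDeriv_natCast (n : ℕ) : ratDeriv (n : RatFunc ℂ) = 0 := by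
  simpa using ratDeriv_C n

@[simp] theorem ratDeriv_ofNat (n : ℕ) [n.AtLeastTwo] :
    ratDeriv (ofNat(n) : RatFunc ℂ) = 0 := ratDeriv_natCast n

@[simp] theorem ratDeriv_neg (f : RatFunc ℂ) : ratDeriv (-f) = -ratDeriv f :=
  map_neg ratDerivation f

@[simp] theorem ratDeriv_sub (f g : RatFunc ℂ) : ratDeriv (f - g) = ratDeriv f - ratDeriv g :=
  map_sub ratDerivation f g

theorem ratDeriv_pow (f : RatFunc ℂ) (n : ℕ) :
    ratDeriv (f ^ n) = n * f ^ (n - 1) * ratDeriv f := by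
  have h := ratDerivation.leibniz_pow f n
  rw [ratDerivation_apply, ratDerivation_apply, nsmul_eq_mul, smul_eq_mul] at h
  rw [h, mul_assoc]

theorem ratDeriv_quot (f g : RatFunc ℂ) (hg : g ≠ 0) :
    ratDeriv (f / g) = (ratDeriv f * g - f * ratDeriv g) / g ^ 2 := by
  have h := ratDeriv_mul (f / g) g
  rw [div_mul_cancel₀ f hg] at h
  rw [h]
  field_simp
  ring

/-- The substitution `f ↦ f ∘ g` for a nonconstant rational function `g`. -/
noncomputable def compHom (g : RatFunc ℂ) (hg : ¬∃ c, g = RatFunc.C c) :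
    RatFunc ℂ →ₐ[ℂ] RatFunc ℂ :=
  RatFunc.liftAlgHom (aeval g) (by
    intro p hp
    rw [Submonoid.mem_comap, mem_nonZeroDivisors_iff_ne_zero]
    -- A nonconstant `g` is transcendental over `ℂ`, so no nonzero denominator vanishes at `g`.
    have := RatFunc.transcendental_of_ne_C g hg
    intro h0
    exact nonZeroDivisors.ne_zero hp ((transcendental_iff.mp this) p h0))

theorem compHom_apply (g : RatFunc ℂ) (hg : ¬∃ c, g = RatFunc.C c) (f : RatFunc ℂ) :
    compHom g hg f = ratComp f g := by
  rw [compHom, RatFunc.liftAlgHom_apply, ratComp, RatFunc.eval]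
  rfl

theorem compHom_C (g : RatFunc ℂ) (hg : ¬∃ c, g = RatFunc.C c) (a : ℂ) :
    compHom g hg (RatFunc.C a) = RatFunc.C a := by
  rw [compHom_apply, ratComp, RatFunc.eval_C]

theorem compHom_X (g : RatFunc ℂ) (hg : ¬∃ c, g = RatFunc.C c) :
    compHom g hg RatFunc.X = g := by
  rw [compHom_apply, ratComp, RatFunc.eval_X]

/-- The chain rule for rational functions. -/
theorem ratDeriv_compHom (g : RatFunc ℂ) (hg : ¬∃ c, g = RatFunc.C c) (f : RatFunc ℂ) :
    ratDeriv (compHom g hg f) = compHom g hg (ratDeriv f) * ratDeriv g := by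
  have key : ∀ p : ℂ[X], ratDeriv (compHom g hg (algebraMap ℂ[X] (RatFunc ℂ) p)) =
      compHom g hg (algebraMap ℂ[X] (RatFunc ℂ) (derivative p)) * ratDeriv g := by
    intro p
    have h : ∀ p : ℂ[X], compHom g hg (algebraMap ℂ[X] (RatFunc ℂ) p) = aeval g p := by
      intro p
      have := RatFunc.liftAlgHom_apply_div (S := ℂ) (aeval g : ℂ[X] →ₐ[ℂ] RatFunc ℂ)
        (by
          intro p hp
          rw [Submonoid.mem_comap, mem_nonZeroDivisors_iff_ne_zero]
          intro h0
          exact nonZeroDivisors.ne_zero hp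
            ((transcendental_iff.mp (RatFunc.transcendental_of_ne_C g hg)) p h0)) p 1
      simpa [compHom] using this
    rw [h, h, ← ratDerivation_apply, ratDerivation.map_aeval, smul_eq_mul, ratDerivation_apply]
  obtain ⟨p, q, hq, rfl⟩ := exists_algebraMap_div f
  have hq' : algebraMap ℂ[X] (RatFunc ℂ) q ≠ 0 := RatFunc.algebraMap_ne_zero hq
  have hq'' : compHom g hg (algebraMap ℂ[X] (RatFunc ℂ) q) ≠ 0 :=
    (map_ne_zero_iff _ (compHom g hg).toRingHom.injective).mpr hq'
  rw [ratDeriv_div _ _ hq, map_div₀, ratDeriv_quot _ _ hq'', key, key]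
  simp only [map_sub, map_mul, map_pow, map_div₀]
  field_simp

/-! ### Gauge equivalence of rational systems -/

theorem map_ratDeriv_mul (S T : Matrix (Fin 2) (Fin 2) (RatFunc ℂ)) :
    (S * T).map ratDeriv = S.map ratDeriv * T + S * T.map ratDeriv := by
  ext i j
  simp only [Matrix.map_apply, Matrix.mul_apply, Matrix.add_apply, Fin.sum_univ_two, ratDeriv_add,
    ratDeriv_mul]
  ring

/-- Gauge equivalence of two rational systems up to a scalar factor: `T' + T A = B T + φ T` with
an invertible rational matrix `T` and a rational function `φ`. -/
def ProjEquiv (A B : Matrix (Fin 2) (Fin 2) (RatFunc ℂ)) : Prop :=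
  ∃ (T : Matrix (Fin 2) (Fin 2) (RatFunc ℂ)) (φ : RatFunc ℂ), T.det ≠ 0 ∧
    T.map ratDeriv + T * A = B * T + φ • T

namespace ProjEquiv

variable {A B D : Matrix (Fin 2) (Fin 2) (RatFunc ℂ)}

theorem refl (A : Matrix (Fin 2) (Fin 2) (RatFunc ℂ)) : ProjEquiv A A := by
  refine ⟨1, 0, by simp, ?_⟩
  ext i j
  fin_cases i <;> fin_cases j <;> simp

theorem trans (h₁ : ProjEquiv A B) (h₂ : ProjEquiv B D) : ProjEquiv A D := by
  obtain ⟨S, φ, hS, h₁⟩ := h₁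
  obtain ⟨T, ψ, hT, h₂⟩ := h₂
  refine ⟨T * S, φ + ψ, by rw [Matrix.det_mul]; exact mul_ne_zero hT hS, ?_⟩
  have e₁ : S.map ratDeriv = B * S + φ • S - S * A := by rw [← h₁]; abel
  have e₂ : T.map ratDeriv = D * T + ψ • T - T * B := by rw [← h₂]; abel
  rw [map_ratDeriv_mul, e₁, e₂]
  simp only [add_mul, sub_mul, mul_add, mul_sub, smul_mul_assoc, mul_smul_comm, add_smul, mul_assoc]
  abel

theorem symm (h : ProjEquiv A B) : ProjEquiv B A := by
  obtain ⟨T, φ, hT, h⟩ := h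
  have hu : IsUnit T.det := isUnit_iff_ne_zero.mpr hT
  have h1 := Matrix.mul_nonsing_inv T hu
  have h2 := Matrix.nonsing_inv_mul T hu
  -- Differentiate `T * T⁻¹ = 1`.
  have hd : (T⁻¹).map ratDeriv = -(T⁻¹ * T.map ratDeriv * T⁻¹) := by
    have h3 := map_ratDeriv_mul T T⁻¹
    have h4 : (1 : Matrix (Fin 2) (Fin 2) (RatFunc ℂ)).map ratDeriv = 0 := by
      ext i j
      fin_cases i <;> fin_cases j <;> simp
    rw [h1, h4] at h3
    have h5 : T * (T⁻¹).map ratDeriv = -(T.map ratDeriv * T⁻¹) := by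
      rw [eq_neg_iff_add_eq_zero, add_comm, ← h3]
    calc (T⁻¹).map ratDeriv = T⁻¹ * (T * (T⁻¹).map ratDeriv) := by
          rw [← mul_assoc, h2, one_mul]
      _ = _ := by rw [h5, mul_neg, mul_assoc]
  refine ⟨T⁻¹, -φ, ?_, ?_⟩
  · rw [Matrix.det_nonsing_inv, Ring.inverse_eq_inv']
    exact inv_ne_zero hT
  · have e : T.map ratDeriv = B * T + φ • T - T * A := by rw [← h]; abel
    rw [hd, e]
    have e1 : T⁻¹ * (B * T) * T⁻¹ = T⁻¹ * B := by rw [mul_assoc, mul_assoc, h1, mul_one]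
    have e2 : T⁻¹ * (T * A) * T⁻¹ = A * T⁻¹ := by rw [← mul_assoc, h2, one_mul]
    have e3 : T⁻¹ * (φ • T) * T⁻¹ = φ • T⁻¹ := by
      rw [mul_smul_comm, h2, smul_mul_assoc, one_mul]
    rw [mul_sub, mul_add, sub_mul, add_mul, e1, e2, e3, neg_smul]
    abel

end ProjEquiv

theorem pullback_eq (g : RatFunc ℂ) (hg : ¬∃ c, g = RatFunc.C c)
    (A : Matrix (Fin 2) (Fin 2) (RatFunc ℂ)) :
    pullback g A = ratDeriv g • A.map (compHom g hg) := by
  rw [pullback]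
  congr 2
  funext f
  rw [compHom_apply]

/-- By the chain rule, the gauge `T ∘ g` works with the scalar `g' · (φ ∘ g)`. -/
theorem ProjEquiv.pullback {A B : Matrix (Fin 2) (Fin 2) (RatFunc ℂ)} (h : ProjEquiv A B)
    (g : RatFunc ℂ) (hg : ¬∃ c, g = RatFunc.C c) :
    ProjEquiv (pullback g A) (pullback g B) := by
  obtain ⟨T, φ, hT, h⟩ := h
  refine ⟨T.map (compHom g hg), ratDeriv g * compHom g hg φ, ?_, ?_⟩
  · have : (T.map (compHom g hg)).det = compHom g hg T.det :=
      (RingHom.map_det (compHom g hg).toRingHom T).symm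
    rw [this]
    exact (map_ne_zero_iff _ (compHom g hg).toRingHom.injective).mpr hT
  · rw [pullback_eq g hg, pullback_eq g hg]
    ext i j
    have hij := congrArg (compHom g hg) (congrFun (congrFun h i) j)
    simp only [Matrix.map_apply, Matrix.mul_apply, Matrix.add_apply, Matrix.smul_apply,
      Fin.sum_univ_two, smul_eq_mul, map_add, map_mul, ratDeriv_compHom] at hij ⊢
    linear_combination ratDeriv g * hij

/-- Since both systems are traceless, taking traces forces `φ` to be half the trace of `T' T⁻¹`,
which is exactly the correction made by the factor `(det T) ^ (-1/2)`. -/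
theorem RSMaps.of_projEquiv {R : RatFunc ℂ} {A B : Matrix (Fin 2) (Fin 2) (RatFunc ℂ)}
    (h : ProjEquiv (pullback R A) B) (hA : A.trace = 0) (hB : B.trace = 0)
    (hR : ¬∃ c, R = RatFunc.C c) : RSMaps R A B := by
  obtain ⟨T, φ, hT, h⟩ := h
  refine ⟨T, hT, ?_⟩
  have hu : IsUnit T.det := isUnit_iff_ne_zero.mpr hT
  have h1 := Matrix.mul_nonsing_inv T hu
  have h2 := Matrix.nonsing_inv_mul T hu
  have key : T.map ratDeriv * T⁻¹ + T * pullback R A * T⁻¹ = B + φ • 1 := by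
    rw [← add_mul, h, add_mul, mul_assoc, h1, mul_one, smul_mul_assoc, h1]
  have htr : (pullback R A).trace = 0 := by
    rw [pullback_eq R hR, Matrix.trace_smul]
    have : (A.map (compHom R hR)).trace = compHom R hR A.trace := by
      simp [Matrix.trace, Fin.sum_univ_two]
    rw [this, hA, map_zero, smul_zero]
  have ht := congrArg Matrix.trace key
  rw [Matrix.trace_add, Matrix.trace_add, Matrix.trace_mul_comm (T * _), ← mul_assoc, h2, one_mul,
    htr, hB, Matrix.trace_smul, Matrix.trace_one] at ht
  have hφ : (T.map ratDeriv * T⁻¹).trace / 2 = φ := by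
    simp at ht
    rw [ht]
    field_simp
  rw [schlesinger, key, hφ]
  abel

/-! ### Gauge transformations in terms of residues at 0 and 1 -/

theorem ratFunc_X_sub_C_ne_zero (a : ℂ) : (RatFunc.X - RatFunc.C a : RatFunc ℂ) ≠ 0 := by
  rw [← RatFunc.algebraMap_X, ← RatFunc.algebraMap_C, ← map_sub]
  exact RatFunc.algebraMap_ne_zero (X_sub_C_ne_zero a)

theorem ratFunc_X_sub_one_ne_zero : (RatFunc.X - 1 : RatFunc ℂ) ≠ 0 := by
  simpa using ratFunc_X_sub_C_ne_zero 1

theorem ratFunc_C_eq_zero {a : ℂ} : RatFunc.C a = 0 ↔ a = 0 := by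
  rw [← map_zero (RatFunc.C (K := ℂ)), RatFunc.C_injective.eq_iff]

theorem coeffMat_apply (A₀ A₁ : Matrix (Fin 2) (Fin 2) ℂ) (i j : Fin 2) :
    coeffMat A₀ A₁ i j = RatFunc.C (A₀ i j) / RatFunc.X + RatFunc.C (A₁ i j) / (RatFunc.X - 1) := by
  simp [coeffMat, constMat, div_eq_inv_mul]

/-- A gauge transformation with a matrix that is linear in the variable. -/
theorem projEquiv_of_linear {E N A₀ A₁ B₀ B₁ : Matrix (Fin 2) (Fin 2) ℂ} {k l : ℂ}
    (hdet : ((RatFunc.X : RatFunc ℂ) • constMat E + constMat N).det ≠ 0)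
    (h₂ : E + E * (A₀ + A₁) = (B₀ + B₁) * E + (k + l) • E)
    (h₁ : N * (A₀ + A₁) - E - E * A₀ = (B₀ + B₁) * N - B₀ * E - k • E + (k + l) • N)
    (h₀ : N * A₀ = B₀ * N + k • N) :
    ProjEquiv (coeffMat A₀ A₁) (coeffMat B₀ B₁) := by
  refine ⟨_, RatFunc.C k / RatFunc.X + RatFunc.C l / (RatFunc.X - 1), hdet, ?_⟩
  have hX : (RatFunc.X : RatFunc ℂ) ≠ 0 := RatFunc.X_ne_zero
  have hX1 := ratFunc_X_sub_one_ne_zero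
  ext i j
  have e₂ := congrArg RatFunc.C (congrFun (congrFun h₂ i) j)
  have e₁ := congrArg RatFunc.C (congrFun (congrFun h₁ i) j)
  have e₀ := congrArg RatFunc.C (congrFun (congrFun h₀ i) j)
  simp only [Matrix.map_apply, Matrix.mul_apply, Matrix.add_apply, Matrix.sub_apply,
    Matrix.smul_apply, Fin.sum_univ_two, smul_eq_mul, coeffMat_apply, constMat, ratDeriv_add,
    ratDeriv_mul, ratDeriv_X, ratDeriv_C, map_add, map_sub, map_mul, mul_zero, zero_add,
    add_zero, mul_one] at e₂ e₁ e₀ ⊢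
  field_simp
  -- After multiplication by `z (z - 1)` the gauge equation is quadratic in `z`; the three
  -- hypotheses are its coefficients.
  linear_combination RatFunc.X ^ 2 * e₂ + RatFunc.X * e₁ - e₀

theorem projEquiv_of_const {K A₀ A₁ B₀ B₁ : Matrix (Fin 2) (Fin 2) ℂ} {k l : ℂ} (hK : K.det ≠ 0)
    (h₀ : K * A₀ = B₀ * K + k • K) (h₁ : K * A₁ = B₁ * K + l • K) :
    ProjEquiv (coeffMat A₀ A₁) (coeffMat B₀ B₁) := by
  refine projEquiv_of_linear (E := 0) (N := K) (k := k) (l := l) ?_ (by simp) ?_ h₀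
  · have : (constMat K).det = RatFunc.C K.det := (RingHom.map_det RatFunc.C K).symm
    have h0 : constMat (0 : Matrix (Fin 2) (Fin 2) ℂ) = 0 := by
      ext i j
      simp [constMat]
    rw [h0, smul_zero, zero_add, this]
    exact mt ratFunc_C_eq_zero.mp hK
  · rw [mul_add, h₀, h₁]
    simp only [zero_mul, mul_zero, smul_zero, sub_zero, add_mul, add_smul]
    abel

theorem not_exists_one_sub_X_eq_C : ¬∃ c : ℂ, (1 - RatFunc.X : RatFunc ℂ) = RatFunc.C c := by
  rintro ⟨c, hc⟩
  have := congrArg ratDeriv hc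
  simp at this

theorem pullback_one_sub_X (A₀ A₁ : Matrix (Fin 2) (Fin 2) ℂ) :
    pullback (1 - RatFunc.X) (coeffMat A₀ A₁) = coeffMat A₁ A₀ := by
  rw [pullback_eq _ not_exists_one_sub_X_eq_C]
  have hX : (RatFunc.X : RatFunc ℂ) ≠ 0 := RatFunc.X_ne_zero
  have hX1 := ratFunc_X_sub_one_ne_zero
  have hX2 : (1 - RatFunc.X : RatFunc ℂ) ≠ 0 := by
    rw [← neg_sub]; exact neg_ne_zero.mpr hX1
  ext i j
  simp only [Matrix.map_apply, Matrix.smul_apply, coeffMat_apply, map_add, map_div₀, compHom_C,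
    compHom_X, map_sub, map_one, ratDeriv_sub, ratDeriv_one, ratDeriv_X, smul_eq_mul]
  have e : (1 - RatFunc.X - 1 : RatFunc ℂ) = -RatFunc.X := by ring
  have e' : (1 - RatFunc.X : RatFunc ℂ) = -(RatFunc.X - 1) := by ring
  rw [e, e']
  generalize RatFunc.C (A₀ i j) = u
  generalize RatFunc.C (A₁ i j) = v
  field_simp
  ring

theorem ProjEquiv.swap {A₀ A₁ B₀ B₁ : Matrix (Fin 2) (Fin 2) ℂ}
    (h : ProjEquiv (coeffMat A₀ A₁) (coeffMat B₀ B₁)) :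
    ProjEquiv (coeffMat A₁ A₀) (coeffMat B₁ B₀) := by
  simpa only [pullback_one_sub_X] using h.pullback _ not_exists_one_sub_X_eq_C

/-! ### Traceless Fuchsian systems and irreducible triples -/

/-- The matrices of a traceless system with the `θ`-triple `(x, y, z)`, without the conditions
`z ≠ 0` and `A₀` not diagonal. -/
structure IsFuchsian (A₀ A₁ : Matrix (Fin 2) (Fin 2) ℂ) (x y z : ℂ) : Prop where
  trace_zero : A₀ 1 1 = -A₀ 0 0
  det_zero : A₀ 0 0 * A₀ 0 0 + A₀ 0 1 * A₀ 1 0 = x ^ 2 / 4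
  det_one : A₁ 0 0 * A₁ 0 0 + A₁ 0 1 * A₁ 1 0 = y ^ 2 / 4
  add_eq : A₀ + A₁ = -(z / 2) • sigma3

namespace IsFuchsian

variable {A₀ A₁ : Matrix (Fin 2) (Fin 2) ℂ} {x y z : ℂ}

theorem one_apply (h : IsFuchsian A₀ A₁ x y z) :
    A₁ 0 0 = -(z / 2) - A₀ 0 0 ∧ A₁ 0 1 = -A₀ 0 1 ∧ A₁ 1 0 = -A₀ 1 0 ∧
      A₁ 1 1 = z / 2 + A₀ 0 0 := by
  have e := h.add_eq
  have e00 := congrFun (congrFun e 0) 0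
  have e01 := congrFun (congrFun e 0) 1
  have e10 := congrFun (congrFun e 1) 0
  have e11 := congrFun (congrFun e 1) 1
  simp [sigma3] at e00 e01 e10 e11
  refine ⟨?_, ?_, ?_, ?_⟩
  · linear_combination e00
  · linear_combination e01
  · linear_combination e10
  · linear_combination e11 - h.trace_zero

/-- Subtracting the two determinant conditions cancels the quadratic terms and leaves a linear
equation for the diagonal entry. -/
theorem zero_zero (h : IsFuchsian A₀ A₁ x y z) (hz : z ≠ 0) :
    A₀ 0 0 = (y ^ 2 - x ^ 2 - z ^ 2) / (4 * z) := by
  obtain ⟨h1, h2, h3, h4⟩ := h.one_apply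
  have e := h.det_one
  rw [h1, h2, h3] at e
  rw [eq_div_iff (by simpa using hz)]
  linear_combination 4 * e - 4 * h.det_zero

theorem swap (h : IsFuchsian A₀ A₁ x y z) : IsFuchsian A₁ A₀ y x z := by
  obtain ⟨h1, h2, h3, h4⟩ := h.one_apply
  exact ⟨by rw [h1, h4]; ring, h.det_one, h.det_zero, by rw [add_comm]; exact h.add_eq⟩

end IsFuchsian

/-- The system with the `θ`-triple `(x, y, z)` has no invariant line, nor has any system with
shifted exponents. -/
def IrredTriple (x y z : ℂ) : Prop :=
  (∀ n : ℤ, z ≠ n) ∧ (∀ n : ℤ, x + y + z ≠ 2 * n) ∧ (∀ n : ℤ, x + y - z ≠ 2 * n) ∧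
    (∀ n : ℤ, x - y + z ≠ 2 * n) ∧ ∀ n : ℤ, -x + y + z ≠ 2 * n

namespace IrredTriple

variable {x y z : ℂ}

theorem ne_zero (h : IrredTriple x y z) : z ≠ 0 := by simpa using h.1 0

theorem neg_left (h : IrredTriple x y z) : IrredTriple (-x) y z := by
  obtain ⟨h0, h1, h2, h3, h4⟩ := h
  refine ⟨h0, fun n e => h4 n ?_, fun n e => h3 (-n) ?_, fun n e => h2 (-n) ?_, fun n e => h1 n ?_⟩
  · linear_combination e
  · push_cast; linear_combination -e
  · push_cast; linear_combination -e
  · linear_combination e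

theorem neg_right (h : IrredTriple x y z) : IrredTriple x y (-z) := by
  obtain ⟨h0, h1, h2, h3, h4⟩ := h
  refine ⟨fun n e => h0 (-n) ?_, fun n e => h2 n ?_, fun n e => h1 n ?_, fun n e => h4 (-n) ?_,
    fun n e => h3 (-n) ?_⟩
  · push_cast; linear_combination -e
  · linear_combination e
  · linear_combination e
  · push_cast; linear_combination -e
  · push_cast; linear_combination -e

theorem swap (h : IrredTriple x y z) : IrredTriple y x z := by
  obtain ⟨h0, h1, h2, h3, h4⟩ := h
  refine ⟨h0, fun n e => h1 n ?_, fun n e => h2 n ?_, fun n e => h4 n ?_, fun n e => h3 n ?_⟩ <;>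
  linear_combination e

theorem shift (h : IrredTriple x y z) (k : ℤ) : IrredTriple (x - k) y (z - k) := by
  obtain ⟨h0, h1, h2, h3, h4⟩ := h
  refine ⟨fun n e => h0 (n + k) ?_, fun n e => h1 (n + k) ?_, fun n e => h2 n ?_,
    fun n e => h3 (n + k) ?_, fun n e => h4 n ?_⟩ <;>
  push_cast <;> linear_combination e

end IrredTriple

/-- As the diagonal is fixed by the triple, the product of the off-diagonal entries is `(x + y + z)
(x + y - z) (x - y + z) (-x + y + z) / (16 z²)`. -/
theorem IsFuchsian.off_diag_ne_zero {A₀ A₁ : Matrix (Fin 2) (Fin 2) ℂ} {x y z : ℂ}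
    (h : IsFuchsian A₀ A₁ x y z) (hi : IrredTriple x y z) : A₀ 0 1 ≠ 0 := by
  intro h0
  have e := h.det_zero
  have hz := hi.ne_zero
  rw [h0, h.zero_zero hz] at e
  field_simp at e
  have e' : (x + y + z) * (x + y - z) * ((x - y + z) * (-x + y + z)) = 0 := by
    linear_combination (-1) * e
  obtain ⟨-, h1, h2, h3, h4⟩ := hi
  rcases mul_eq_zero.mp e' with e' | e' <;> rcases mul_eq_zero.mp e' with e' | e'
  · exact h1 0 (by simpa using e')
  · exact h2 0 (by simpa using e')
  · exact h3 0 (by simpa using e')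
  · exact h4 0 (by simpa using e')

/-! ### Canonical systems and their contiguity -/

/-- The residue at `0` of the system with the `θ`-triple `(x, y, z)`, normalized so that its upper
right entry is `1`. -/
noncomputable def canonicalZero (x y z : ℂ) : Matrix (Fin 2) (Fin 2) ℂ :=
  !![(y ^ 2 - x ^ 2 - z ^ 2) / (4 * z), 1;
    x ^ 2 / 4 - ((y ^ 2 - x ^ 2 - z ^ 2) / (4 * z)) ^ 2, -((y ^ 2 - x ^ 2 - z ^ 2) / (4 * z))]

noncomputable def canonicalOne (x y z : ℂ) : Matrix (Fin 2) (Fin 2) ℂ :=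
  -(z / 2) • sigma3 - canonicalZero x y z

noncomputable def canonicalMat (x y z : ℂ) : Matrix (Fin 2) (Fin 2) (RatFunc ℂ) :=
  coeffMat (canonicalZero x y z) (canonicalOne x y z)

theorem isFuchsian_canonical (x y : ℂ) {z : ℂ} (hz : z ≠ 0) :
    IsFuchsian (canonicalZero x y z) (canonicalOne x y z) x y z := by
  constructor
  · simp [canonicalZero]
  · simp [canonicalZero]; ring
  · simp [canonicalZero, canonicalOne, sigma3]; field_simp; ring
  · simp [canonicalOne]

/-- The triple determines everything except the scale of the off-diagonal entries, and conjugation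
by a diagonal matrix normalizes it without disturbing `σ₃`. Hence the gauge class depends on the
triple alone. -/
theorem IsFuchsian.projEquiv_canonical {A₀ A₁ : Matrix (Fin 2) (Fin 2) ℂ} {x y z : ℂ}
    (h : IsFuchsian A₀ A₁ x y z) (hi : IrredTriple x y z) :
    ProjEquiv (coeffMat A₀ A₁) (canonicalMat x y z) := by
  have hb := h.off_diag_ne_zero hi
  have ha := h.zero_zero hi.ne_zero
  have hd := h.det_zero
  obtain ⟨h1, h2, h3, h4⟩ := h.one_apply
  have ht := h.trace_zero
  have hc : canonicalZero x y z = !![A₀ 0 0, 1; x ^ 2 / 4 - A₀ 0 0 ^ 2, -A₀ 0 0] := by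
    rw [canonicalZero, ha]
  rw [canonicalMat]
  refine projEquiv_of_const (K := !![1, 0; 0, A₀ 0 1]) (k := 0) (l := 0) (by simpa using hb) ?_ ?_
  · ext i j
    fin_cases i <;> fin_cases j <;>
      simp [hc, Matrix.mul_apply, Fin.sum_univ_two, ht, mul_comm]
    linear_combination hd
  · ext i j
    fin_cases i <;> fin_cases j <;>
      simp [hc, canonicalOne, sigma3, Matrix.mul_apply, Fin.sum_univ_two, h1, h2, h3, h4]
    · linear_combination -hd
    · ring

theorem canonicalMat_neg_left (x y z : ℂ) : canonicalMat (-x) y z = canonicalMat x y z := by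
  simp [canonicalMat, canonicalOne, canonicalZero]

theorem canonicalMat_neg_middle (x y z : ℂ) : canonicalMat x (-y) z = canonicalMat x y z := by
  simp [canonicalMat, canonicalOne, canonicalZero]

/-- Exchanging the two basis vectors turns `σ₃` into `-σ₃`. -/
theorem projEquiv_neg_right {x y z : ℂ} (hi : IrredTriple x y z) :
    ProjEquiv (canonicalMat x y z) (canonicalMat x y (-z)) := by
  have h := isFuchsian_canonical x y hi.ne_zero
  set A₀ := canonicalZero x y z
  set A₁ := canonicalOne x y z
  obtain ⟨h1, h2, h3, h4⟩ := h.one_apply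
  have ht := h.trace_zero
  have key : IsFuchsian !![A₀ 1 1, A₀ 1 0; A₀ 0 1, A₀ 0 0] !![A₁ 1 1, A₁ 1 0; A₁ 0 1, A₁ 0 0]
      x y (-z) := by
    constructor
    · simp [ht]
    · simp [ht]; linear_combination h.det_zero
    · have := h.det_one
      simp [h1, h2, h3, h4] at this ⊢; linear_combination this
    · ext i j
      fin_cases i <;> fin_cases j <;> simp [sigma3, h1, h2, h3, h4, ht] <;> ring
  refine ProjEquiv.trans ?_ (key.projEquiv_canonical hi.neg_right)
  refine projEquiv_of_const (K := !![0, 1; 1, 0]) (k := 0) (l := 0) (by simp) ?_ ?_ <;>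
  · ext i j
    fin_cases i <;> fin_cases j <;> simp [Matrix.mul_apply, Fin.sum_univ_two, A₀, A₁]

/-- The substitution `z ↦ 1 - z` carries statements about `θ₀` over to `θ₁`. -/
theorem projEquiv_swap {x y z : ℂ} (hi : IrredTriple x y z) {x' y' z' : ℂ}
    (hi' : IrredTriple x' y' z')
    (h : ProjEquiv (canonicalMat x y z) (canonicalMat x' y' z')) :
    ProjEquiv (canonicalMat y x z) (canonicalMat y' x' z') :=
  (((isFuchsian_canonical x y hi.ne_zero).swap.projEquiv_canonical hi.swap).symm.trans
    h.swap).trans ((isFuchsian_canonical x' y' hi'.ne_zero).swap.projEquiv_canonical hi'.swap)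

/-- The elementary Schlesinger transformation that shifts `θ₀` and `θ_∞` by `-1`. -/
theorem projEquiv_shift_one {x y z : ℂ} (hi : IrredTriple x y z) :
    ProjEquiv (canonicalMat x y z) (canonicalMat (x - 1) y (z - 1)) := by
  have hi' : IrredTriple (x - 1) y (z - 1) := by simpa using hi.shift 1
  have hz := hi.ne_zero
  have hz' := hi'.ne_zero
  set a := (y ^ 2 - x ^ 2 - z ^ 2) / (4 * z) with ha
  -- The gauge `[[X + q r, q], [r, 1]]` has determinant `X`. Its constant term is the rank-one
  -- matrix `(q, 1)ᵀ (r, 1)`: the row `(r, 1)` is a left eigenvector of the residue at `0` for `x /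
  -- 2`, and `q` is forced by keeping the residue sum diagonal.
  set q := 1 / (z - 1) with hq
  set r := x / 2 + a with hr
  have key : IsFuchsian !![a + 1 / 2 + q * r, q * (x / 2 - 1 - a - q * r);
        r * z, -(a + 1 / 2 + q * r)]
      (-((z - 1) / 2) • sigma3 - !![a + 1 / 2 + q * r, q * (x / 2 - 1 - a - q * r);
        r * z, -(a + 1 / 2 + q * r)]) (x - 1) y (z - 1) := by
    constructor
    · simp
    · simp [ha, hq, hr]; field_simp; ring
    · simp [ha, hq, hr, sigma3]; field_simp; ring
    · simp
  refine ProjEquiv.trans ?_ (key.projEquiv_canonical hi')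
  rw [canonicalMat]
  refine projEquiv_of_linear (E := !![1, 0; 0, 0]) (N := !![q * r, q; r, 1]) (k := 1 / 2) (l := 0)
    ?_ ?_ ?_ ?_
  · have : ((RatFunc.X : RatFunc ℂ) • constMat !![1, 0; 0, 0] + constMat !![q * r, q; r, 1]).det =
        RatFunc.X := by
      simp [Matrix.det_fin_two, constMat]
    rw [this]
    exact RatFunc.X_ne_zero
  · ext i j
    fin_cases i <;> fin_cases j <;> simp [canonicalOne, sigma3]
    ring
  · ext i j
    fin_cases i <;> fin_cases j <;>
      simp [canonicalOne, canonicalZero, sigma3, ha, hq, hr] <;>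
      field_simp <;> ring
  · ext i j
    fin_cases i <;> fin_cases j <;>
      simp [canonicalZero, Matrix.mul_apply, Fin.sum_univ_two, ha, hq, hr] <;>
      field_simp <;> ring

/-! ### Sign changes and even integer shifts -/

theorem IsHypergeometric.isFuchsian {A₀ A₁ : Matrix (Fin 2) (Fin 2) ℂ} {θ : Fin 3 → ℂ}
    (h : IsHypergeometric A₀ A₁ θ) : IsFuchsian A₀ A₁ (θ 0) (θ 1) (θ 2) := by
  have key : ∀ (A : Matrix (Fin 2) (Fin 2) ℂ) (a : ℂ), A.charpoly = (X - C a) * (X + C a) →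
      A 1 1 = -A 0 0 ∧ A 0 0 * A 0 0 + A 0 1 * A 1 0 = a ^ 2 := by
    intro A a hA
    rw [Matrix.charpoly_fin_two, Matrix.trace_fin_two, Matrix.det_fin_two] at hA
    have h0 := congrArg (Polynomial.eval 0) hA
    have h1 := congrArg (Polynomial.eval 1) hA
    simp at h0 h1
    have ht : A 1 1 = -A 0 0 := by linear_combination h0 - h1
    refine ⟨ht, ?_⟩
    rw [ht] at h0
    linear_combination -h0
  obtain ⟨h1, h2⟩ := key _ _ h.charpoly_zero
  obtain ⟨h3, h4⟩ := key _ _ h.charpoly_one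
  exact ⟨h1, by rw [h2]; ring, by rw [h4]; ring, h.add_eq⟩

theorem IsFuchsian.trace_coeffMat {A₀ A₁ : Matrix (Fin 2) (Fin 2) ℂ} {x y z : ℂ}
    (h : IsFuchsian A₀ A₁ x y z) : (coeffMat A₀ A₁).trace = 0 := by
  obtain ⟨h1, h2, h3, h4⟩ := h.one_apply
  have : A₁ 1 1 = -A₁ 0 0 := by rw [h1, h4]; ring
  rw [Matrix.trace_fin_two, coeffMat_apply, coeffMat_apply, h.trace_zero, this]
  simp
  ring

theorem projEquiv_shift_nat {x y z : ℂ} (hi : IrredTriple x y z) (n : ℕ) :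
    ProjEquiv (canonicalMat x y z) (canonicalMat (x - n) y (z - n)) := by
  induction n with
  | zero => simpa using ProjEquiv.refl _
  | succ n ih =>
    have h := projEquiv_shift_one (by simpa using hi.shift n : IrredTriple (x - n) y (z - n))
    have e : ∀ w : ℂ, w - ((n + 1 : ℕ) : ℂ) = w - n - 1 := fun w => by push_cast; ring
    rw [e, e]
    exact ih.trans h

theorem projEquiv_shift_left {x y z : ℂ} (hi : IrredTriple x y z) (k : ℤ) :
    ProjEquiv (canonicalMat x y z) (canonicalMat (x - k) y (z - k)) := by
  obtain ⟨n, rfl | rfl⟩ := k.eq_nat_or_neg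
  · simpa using projEquiv_shift_nat hi n
  · have h := projEquiv_shift_nat (hi.shift (-n)) n
    simpa using h.symm

/-- The sign of `x` is invisible in the canonical form, so `θ₀` may also move opposite to `θ_∞`. -/
theorem projEquiv_shift_left' {x y z : ℂ} (hi : IrredTriple x y z) (k : ℤ) :
    ProjEquiv (canonicalMat x y z) (canonicalMat (x + k) y (z - k)) := by
  have h := projEquiv_shift_left hi.neg_left k
  rw [canonicalMat_neg_left] at h
  rwa [← canonicalMat_neg_left (x + k), neg_add']

theorem IrredTriple.shift' {x y z : ℂ} (hi : IrredTriple x y z) (k : ℤ) :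
    IrredTriple (x + k) y (z - k) := by
  have := (hi.neg_left.shift k).neg_left
  rwa [neg_sub, sub_neg_eq_add, add_comm] at this

theorem projEquiv_shift_middle {x y z : ℂ} (hi : IrredTriple x y z) (k : ℤ) :
    ProjEquiv (canonicalMat x y z) (canonicalMat x (y - k) (z - k)) :=
  projEquiv_swap hi.swap (hi.swap.shift k) (projEquiv_shift_left hi.swap k)

/-- Systems whose triples differ by integers with even sum are gauge equivalent. -/
theorem projEquiv_shift {x y z : ℂ} (hi : IrredTriple x y z) {l₀ l₁ l₂ : ℤ}
    (hl : Even (l₀ + l₁ + l₂)) : IrredTriple (l₀ + x) (l₁ + y) (l₂ + z) ∧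
      ProjEquiv (canonicalMat x y z) (canonicalMat (l₀ + x) (l₁ + y) (l₂ + z)) := by
  obtain ⟨m, hm⟩ := hl
  obtain rfl : l₂ = m + m - l₀ - l₁ := by omega
  -- The vectors `(-1, 0, -1)`, `(1, 0, -1)`, `(0, -1, -1)` generate the lattice of integer triples
  -- with even sum; the multiples are `l₁ - m`, `l₀ + l₁ - m`, `-l₁`.
  have i₁ := hi.shift (l₁ - m)
  have i₂ := i₁.shift' (l₀ + l₁ - m)
  have i₃ := (i₂.swap.shift (-l₁)).swap
  have e := ((projEquiv_shift_left hi (l₁ - m)).trans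
    (projEquiv_shift_left' i₁ (l₀ + l₁ - m))).trans (projEquiv_shift_middle i₂ (-l₁))
  have e₀ : x - ((l₁ - m : ℤ) : ℂ) + ((l₀ + l₁ - m : ℤ) : ℂ) = l₀ + x := by push_cast; ring
  have e₁ : y - ((-l₁ : ℤ) : ℂ) = l₁ + y := by push_cast; ring
  have e₂ : z - ((l₁ - m : ℤ) : ℂ) - ((l₀ + l₁ - m : ℤ) : ℂ) - ((-l₁ : ℤ) : ℂ) =
      ((m + m - l₀ - l₁ : ℤ) : ℂ) + z := by push_cast; ring
  rw [e₀, e₁, e₂] at e i₃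
  exact ⟨i₃, e⟩

theorem projEquiv_sign {x y z : ℂ} (hi : IrredTriple x y z) (ε₀ ε₁ ε₂ : ℤˣ) :
    IrredTriple ((ε₀ : ℤ) * x) ((ε₁ : ℤ) * y) ((ε₂ : ℤ) * z) ∧
      ProjEquiv (canonicalMat x y z)
        (canonicalMat ((ε₀ : ℤ) * x) ((ε₁ : ℤ) * y) ((ε₂ : ℤ) * z)) := by
  have h₀ : IrredTriple ((ε₀ : ℤ) * x) y z ∧
      ProjEquiv (canonicalMat x y z) (canonicalMat ((ε₀ : ℤ) * x) y z) := by
    rcases Int.units_eq_one_or ε₀ with rfl | rfl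
    · simpa using ⟨hi, ProjEquiv.refl _⟩
    · simpa [canonicalMat_neg_left] using ⟨hi.neg_left, ProjEquiv.refl _⟩
  generalize ((ε₀ : ℤ) : ℂ) * x = x' at h₀ ⊢
  have h₁ : IrredTriple x' ((ε₁ : ℤ) * y) z ∧
      ProjEquiv (canonicalMat x y z) (canonicalMat x' ((ε₁ : ℤ) * y) z) := by
    rcases Int.units_eq_one_or ε₁ with rfl | rfl
    · simpa using h₀
    · simpa [canonicalMat_neg_middle] using ⟨h₀.1.swap.neg_left.swap, h₀.2⟩
  generalize ((ε₁ : ℤ) : ℂ) * y = y' at h₁ ⊢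
  rcases Int.units_eq_one_or ε₂ with rfl | rfl
  · simpa using h₁
  · simpa using ⟨h₁.1.neg_right, h₁.2.trans (projEquiv_neg_right h₁.1)⟩

theorem ShiftEquiv.projEquiv_canonical {τ θ : Fin 3 → ℂ} (h : ShiftEquiv τ θ)
    (hi : IrredTriple (τ 0) (τ 1) (τ 2)) : IrredTriple (θ 0) (θ 1) (θ 2) ∧
      ProjEquiv (canonicalMat (τ 0) (τ 1) (τ 2)) (canonicalMat (θ 0) (θ 1) (θ 2)) := by
  obtain ⟨ε, l, hl, h⟩ := h
  rw [Fin.sum_univ_three] at hl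
  obtain ⟨i₁, e₁⟩ := projEquiv_sign hi (ε 0) (ε 1) (ε 2)
  obtain ⟨i₂, e₂⟩ := projEquiv_shift i₁ hl
  rw [h 0, h 1, h 2]
  exact ⟨i₂, e₁.trans e₂⟩

theorem ShiftEquiv.projEquiv {τ θ : Fin 3 → ℂ} (h : ShiftEquiv τ θ)
    (hi : IrredTriple (τ 0) (τ 1) (τ 2)) {A₀ A₁ B₀ B₁ : Matrix (Fin 2) (Fin 2) ℂ}
    (hA : IsFuchsian A₀ A₁ (τ 0) (τ 1) (τ 2)) (hB : IsFuchsian B₀ B₁ (θ 0) (θ 1) (θ 2)) :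
    ProjEquiv (coeffMat A₀ A₁) (coeffMat B₀ B₁) := by
  obtain ⟨i, e⟩ := h.projEquiv_canonical hi
  exact ((hA.projEquiv_canonical hi).trans e).trans (hB.projEquiv_canonical i).symm

/-! ### The triples of rows 2 and 3 -/

theorem irredTriple_third_half_third : IrredTriple (1 / 3) (1 / 2) (1 / 3) := by
  refine ⟨fun n h => ?_, fun n h => ?_, fun n h => ?_, fun n h => ?_, fun n h => ?_⟩
  · have : (1 : ℂ) = 3 * n := by linear_combination 3 * h
    have : (1 : ℤ) = 3 * n := by exact_mod_cast this
    omega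
  · have : (7 : ℂ) = 12 * n := by linear_combination 6 * h
    have : (7 : ℤ) = 12 * n := by exact_mod_cast this
    omega
  · have : (3 : ℂ) = 12 * n := by linear_combination 6 * h
    have : (3 : ℤ) = 12 * n := by exact_mod_cast this
    omega
  · have : (1 : ℂ) = 12 * n := by linear_combination 6 * h
    have : (1 : ℤ) = 12 * n := by exact_mod_cast this
    omega
  · have : (3 : ℂ) = 12 * n := by linear_combination 6 * h
    have : (3 : ℤ) = 12 * n := by exact_mod_cast this
    omega

theorem irredTriple_third : IrredTriple (1 / 3) (1 / 3) (1 / 3) := by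
  have h : ∀ n : ℤ, (1 / 3 : ℂ) ≠ 2 * n := by
    intro n h
    have : (1 : ℂ) = 6 * n := by linear_combination 3 * h
    have : (1 : ℤ) = 6 * n := by exact_mod_cast this
    omega
  refine ⟨fun n h => ?_, fun n h => ?_, fun n e => h n ?_, fun n e => h n ?_, fun n e => h n ?_⟩
  · have : (1 : ℂ) = 3 * n := by linear_combination 3 * h
    have : (1 : ℤ) = 3 * n := by exact_mod_cast this
    omega
  · have : (1 : ℂ) = 2 * n := by linear_combination h
    have : (1 : ℤ) = 2 * n := by exact_mod_cast this
    omega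
  all_goals linear_combination e

theorem correspondsTo_schwarzRow2 {θ : Fin 3 → ℂ} (h : ShiftEquiv ![1 / 3, 1 / 2, 1 / 3] θ) :
    CorrespondsTo schwarzRow2 θ := by
  obtain ⟨ε, l, hl, h⟩ := h
  -- The `-1` in `θ_∞ - 1` makes the shift odd. Parity is restored on the entry `1/2`, where `ε/2 =
  -- ε - ε/2` trades a sign for an odd shift.
  refine ⟨Equiv.swap 0 2, ![ε 2, ε 0, -ε 1], ![l 2 - 1, l 0, l 1 + ε 1], ?_, ?_⟩
  · rw [Fin.sum_univ_three] at hl ⊢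
    obtain ⟨m, hm⟩ := hl
    simp only [Matrix.cons_val]
    rcases Int.units_eq_one_or (ε 1) with e | e <;> rw [e]
    · exact ⟨m, by push_cast; omega⟩
    · exact ⟨m - 1, by push_cast; omega⟩
  · have h0 := h 0
    have h1 := h 1
    have h2 := h 2
    simp only [Matrix.cons_val] at h0 h1 h2
    intro i
    fin_cases i
    · have : Equiv.swap (0 : Fin 3) 2 0 = 2 := by decide
      simp [this, schwarzRow2, h2]
      ring
    · have : Equiv.swap (0 : Fin 3) 2 1 = 1 := by decide
      simp [this, schwarzRow2, h0]
    · have : Equiv.swap (0 : Fin 3) 2 2 = 0 := by decide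
      simp [this, schwarzRow2, h1]
      ring

/-- Since `2/3 = 1 - 1/3`, row 3 is `(1/3, 1/3, 1/3)` up to a sign and an odd shift, which cancels
the parity of the `-1` in `θ_∞ - 1`. All entries then agree, so the permutation disappears. -/
theorem shiftEquiv_of_correspondsTo_schwarzRow3 {θ : Fin 3 → ℂ}
    (h : CorrespondsTo schwarzRow3 θ) : ShiftEquiv ![1 / 3, 1 / 3, 1 / 3] θ := by
  obtain ⟨σ, ε, l, hl, h⟩ := h
  -- `s` and `t` record `2/3 = 1 + (-1) · 1/3` at the position to which the permutation takes the
  -- entry `2/3`.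
  set s : Fin 3 → ℤˣ := fun i => if σ i = 0 then -1 else 1 with hs
  set t : Fin 3 → ℤ := fun i => if σ i = 0 then 1 else 0 with ht
  have hrow : ∀ i, schwarzRow3 (σ i) = t i + ((s i : ℤ) : ℂ) * (1 / 3) := by
    intro i
    simp only [hs, ht]
    generalize σ i = j
    fin_cases j <;> simp [schwarzRow3]
    norm_num
  have hsum : t 0 + t 1 + t 2 = 1 := by
    have : ∑ i, t i = 1 := by
      simp only [ht]
      rw [Equiv.sum_comp σ (fun j => if j = 0 then (1 : ℤ) else 0)]
      simp
    rwa [Fin.sum_univ_three] at this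
  have hpar : ∀ i, ∃ k : ℤ, (ε i : ℤ) * t i = t i + 2 * k := by
    intro i
    rcases Int.units_eq_one_or (ε i) with e | e <;> rw [e]
    · exact ⟨0, by simp⟩
    · exact ⟨-t i, by push_cast; ring⟩
  obtain ⟨k0, hk0⟩ := hpar 0
  obtain ⟨k1, hk1⟩ := hpar 1
  obtain ⟨k2, hk2⟩ := hpar 2
  have h0 := h 0
  have h1 := h 1
  have h2 := h 2
  simp only [hrow, Matrix.cons_val] at h0 h1 h2
  refine ⟨![ε 1 * s 1, ε 2 * s 2, ε 0 * s 0],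
    ![l 1 + ε 1 * t 1, l 2 + ε 2 * t 2, l 0 + ε 0 * t 0 + 1], ?_, ?_⟩
  · rw [Fin.sum_univ_three] at hl ⊢
    obtain ⟨m, hm⟩ := hl
    simp only [Matrix.cons_val, hk0, hk1, hk2]
    exact ⟨m + k0 + k1 + k2 + 1, by linear_combination hm + hsum⟩
  · intro i
    fin_cases i
    · simp [h1]; ring
    · simp [h2]; ring
    · simp
      linear_combination h0

/-! ### The covering of degree 6 and its critical points -/

/-- The normalized covering in terms of the parameter `m`. -/
noncomputable def tetrahedralCover (m : ℂ) : RatFunc ℂ :=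
  4 * (RatFunc.X * (RatFunc.X - 1) *
      (RatFunc.C (1 - 2 * m) * RatFunc.X - RatFunc.C (m ^ 3 * (m - 2))) ^ 3) /
    (RatFunc.X ^ 2 - RatFunc.C (2 * m * (2 * m ^ 2 - 3 * m + 2)) * RatFunc.X +
      RatFunc.C (m ^ 4)) ^ 3

/-- The monic quadratic polynomial whose roots are the poles of the covering. -/
noncomputable def coverPole (m : ℂ) : RatFunc ℂ :=
  RatFunc.X ^ 2 - 2 * RatFunc.C m * (2 * RatFunc.C m ^ 2 - 3 * RatFunc.C m + 2) * RatFunc.X +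
    RatFunc.C m ^ 4

/-- The monic cubic polynomial whose roots are the points over `1`. -/
noncomputable def coverOne (m : ℂ) : RatFunc ℂ :=
  RatFunc.X ^ 3 +
    (10 * RatFunc.C m ^ 3 - 15 * RatFunc.C m ^ 2 + 6 * RatFunc.C m - 2) * RatFunc.X ^ 2 -
    RatFunc.C m ^ 3 * (2 * RatFunc.C m ^ 3 - 6 * RatFunc.C m ^ 2 + 15 * RatFunc.C m - 10) *
      RatFunc.X + RatFunc.C m ^ 6

/-- A linear polynomial vanishing at the triple zero of the covering. -/
noncomputable def coverTriple (m : ℂ) : RatFunc ℂ :=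
  (1 - 2 * RatFunc.C m) * RatFunc.X - RatFunc.C m ^ 3 * (RatFunc.C m - 2)

/-- A linear polynomial vanishing at the additional critical point of the covering. -/
noncomputable def coverCritical (m : ℂ) : RatFunc ℂ :=
  (1 - 2 * RatFunc.C m) * RatFunc.X - RatFunc.C m * (RatFunc.C m - 2)

theorem ratFunc_C_ofNat (n : ℕ) [n.AtLeastTwo] :
    RatFunc.C (ofNat(n) : ℂ) = (ofNat(n) : RatFunc ℂ) := map_ofNat _ n

theorem tetrahedralCover_eq (m : ℂ) : tetrahedralCover m =
    4 * (RatFunc.X * (RatFunc.X - 1) * coverTriple m ^ 3) / coverPole m ^ 3 := by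
  simp only [tetrahedralCover, coverTriple, coverPole, map_mul, map_sub, map_add, map_pow, map_one,
    ratFunc_C_ofNat]

theorem coverPole_ne_zero (m : ℂ) : coverPole m ≠ 0 := by
  have : coverPole m = algebraMap ℂ[X] (RatFunc ℂ)
      (X ^ 2 - C (2 * m * (2 * m ^ 2 - 3 * m + 2)) * X + C (m ^ 4)) := by
    simp only [coverPole, map_mul, map_sub, map_add, map_pow, RatFunc.algebraMap_C,
      RatFunc.algebraMap_X, ratFunc_C_ofNat]
  rw [this]
  exact RatFunc.algebraMap_ne_zero (Monic.ne_zero (by monicity!))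

theorem coverOne_ne_zero (m : ℂ) : coverOne m ≠ 0 := by
  have : coverOne m = algebraMap ℂ[X] (RatFunc ℂ)
      (X ^ 3 + C (10 * m ^ 3 - 15 * m ^ 2 + 6 * m - 2) * X ^ 2 -
        C (m ^ 3 * (2 * m ^ 3 - 6 * m ^ 2 + 15 * m - 10)) * X + C (m ^ 6)) := by
    simp only [coverOne, map_mul, map_sub, map_add, map_pow, RatFunc.algebraMap_C,
      RatFunc.algebraMap_X, ratFunc_C_ofNat]
  rw [this]
  exact RatFunc.algebraMap_ne_zero (Monic.ne_zero (by monicity!))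

theorem coverParam_ne_zero {m : ℂ} (hm : 1 - 2 * m ≠ 0) : (1 - 2 * RatFunc.C m) ≠ 0 := by
  have : (1 - 2 * RatFunc.C m) = RatFunc.C (1 - 2 * m) := by
    simp only [map_mul, map_sub, map_one, ratFunc_C_ofNat]
  rw [this]
  exact mt ratFunc_C_eq_zero.mp hm

theorem coverTriple_ne_zero {m : ℂ} (hm : 1 - 2 * m ≠ 0) : coverTriple m ≠ 0 := by
  have : coverTriple m = algebraMap ℂ[X] (RatFunc ℂ)
      (C (1 - 2 * m) * X - C (m ^ 3 * (m - 2))) := by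
    simp only [coverTriple, map_mul, map_sub, map_pow, map_one, RatFunc.algebraMap_C,
      RatFunc.algebraMap_X, ratFunc_C_ofNat]
  rw [this]
  refine RatFunc.algebraMap_ne_zero fun h => ?_
  have := congrArg (coeff · 1) h
  rw [coeff_sub, coeff_C_mul, coeff_X_one, coeff_C_of_ne_zero one_ne_zero] at this
  simp at this
  exact hm this

theorem tetrahedralCover_sub_one (m : ℂ) :
    tetrahedralCover m - 1 = -(coverOne m ^ 2 / coverPole m ^ 3) := by
  have h := coverPole_ne_zero m
  rw [tetrahedralCover_eq]
  field_simp
  simp only [coverTriple, coverPole, coverOne]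
  ring

theorem ratDeriv_coverPole (m : ℂ) : ratDeriv (coverPole m) =
    2 * RatFunc.X - 2 * RatFunc.C m * (2 * RatFunc.C m ^ 2 - 3 * RatFunc.C m + 2) := by
  simp [coverPole, ratDeriv_add, ratDeriv_mul, ratDeriv_pow]

theorem ratDeriv_coverOne (m : ℂ) : ratDeriv (coverOne m) = 3 * RatFunc.X ^ 2 +
    2 * (10 * RatFunc.C m ^ 3 - 15 * RatFunc.C m ^ 2 + 6 * RatFunc.C m - 2) * RatFunc.X -
    RatFunc.C m ^ 3 * (2 * RatFunc.C m ^ 3 - 6 * RatFunc.C m ^ 2 + 15 * RatFunc.C m - 10) := by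
  simp [coverOne, ratDeriv_add, ratDeriv_mul, ratDeriv_pow]
  ring

theorem ratDeriv_coverTriple (m : ℂ) : ratDeriv (coverTriple m) = 1 - 2 * RatFunc.C m := by
  simp [coverTriple, ratDeriv_mul, ratDeriv_pow]

/-- In the generic case, Riemann–Hurwitz in degree 6 asks for ramification 10, while the fibres over
`0, 1, ∞` account for `2 + 3 + 4`; the factor `coverCritical` is the one remaining critical point.
-/
theorem ratDeriv_tetrahedralCover (m : ℂ) : ratDeriv (tetrahedralCover m) =
    -(4 * coverOne m * coverCritical m * coverTriple m ^ 2 / coverPole m ^ 4) := by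
  have h := coverPole_ne_zero m
  rw [tetrahedralCover_eq, ratDeriv_quot _ _ (pow_ne_zero 3 h)]
  simp only [ratDeriv_mul, ratDeriv_pow, ratDeriv_sub, ratDeriv_ofNat, ratDeriv_one, ratDeriv_X,
    ratDeriv_coverPole, ratDeriv_coverTriple]
  field_simp
  simp only [coverTriple, coverPole, coverOne, coverCritical]
  push_cast
  ring

theorem coverCritical_ne_zero {m : ℂ} (hm : 1 - 2 * m ≠ 0) : coverCritical m ≠ 0 := by
  intro h
  have h' := congrArg ratDeriv h
  simp [coverCritical, ratDeriv_mul] at h'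
  exact coverParam_ne_zero hm h'

theorem tetrahedralCover_not_const {m : ℂ} (hm : 1 - 2 * m ≠ 0) :
    ¬∃ c, tetrahedralCover m = RatFunc.C c := by
  rintro ⟨c, hc⟩
  have h := ratDeriv_tetrahedralCover m
  rw [hc, ratDeriv_C, eq_comm, neg_eq_zero] at h
  have h1 := coverPole_ne_zero m
  have h2 := coverOne_ne_zero m
  have h3 := coverTriple_ne_zero hm
  have h4 := coverCritical_ne_zero hm
  simp [h1, h2, h3, h4] at h

/-! ### The explicit pullback from row 2 to row 3 -/

/-- The pullback of the system satisfied by `(f, z f')`, where `f` is the hypergeometric function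
`₂F₁(-1/12, 1/4; 2/3; z)`, is a Fuchsian system with singularities at `0, 1, ∞` only. -/
theorem projEquiv_pullback_tetrahedralCover {m : ℂ} (hm : 1 - 2 * m ≠ 0) :
    ProjEquiv
      (pullback (tetrahedralCover m) (coeffMat !![0, 1; 0, 1 / 3] !![0, 0; 1 / 48, -1 / 2]))
      (coeffMat !![(2 - m) / 6, m * (m - 2) / (1 - 2 * m); -(1 - 2 * m) / 36, 1 / 3 - (2 - m) / 6]
        !![1 / 2 - (2 - m) / 6, 1 - m * (m - 2) / (1 - 2 * m);
          (1 - 2 * m) / 36, (2 - m) / 6 - 1 / 6]) := by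
  have hX : (RatFunc.X : RatFunc ℂ) ≠ 0 := RatFunc.X_ne_zero
  have hX1 := ratFunc_X_sub_one_ne_zero
  have h0 := coverParam_ne_zero hm
  have h1 := coverPole_ne_zero m
  have h2 := coverOne_ne_zero m
  have h3 := coverTriple_ne_zero hm
  have hR := tetrahedralCover_not_const hm
  -- `P` and `Q` are `R'/R` and `R'/(R - 1)` in factored form.
  set P : RatFunc ℂ := -(coverOne m * coverCritical m /
    (RatFunc.X * (RatFunc.X - 1) * coverTriple m * coverPole m)) with hP
  set Q : RatFunc ℂ := 4 * coverTriple m ^ 2 * coverCritical m / (coverPole m * coverOne m) with hQ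
  have key : ∀ a b : ℂ, ratDeriv (tetrahedralCover m) *
      (RatFunc.C a / tetrahedralCover m + RatFunc.C b / (tetrahedralCover m - 1)) =
        P * RatFunc.C a + Q * RatFunc.C b := by
    intro a b
    rw [ratDeriv_tetrahedralCover, tetrahedralCover_sub_one, tetrahedralCover_eq, hP, hQ]
    field_simp
    ring
  have hA : pullback (tetrahedralCover m)
      (coeffMat !![0, 1; 0, 1 / 3] !![0, 0; 1 / 48, -1 / 2]) =
        !![0, P; Q / 48, P / 3 - Q / 2] := by
    rw [pullback_eq _ hR]
    ext i j
    simp only [Matrix.smul_apply, Matrix.map_apply, coeffMat_apply, map_add, map_div₀, map_sub,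
      map_one, compHom_C, compHom_X, smul_eq_mul]
    rw [key]
    fin_cases i <;> fin_cases j <;> simp [ratFunc_C_ofNat] <;> ring
  rw [hA]
  -- With `H = coverPole m`, the scalar `H ^ (-3/4)` makes the first component `H ^ (1/4) f(R)`,
  -- whose exponents at the poles of `R` are `0, 1`. The upper right entry of the target vanishes at
  -- the root of `coverCritical`, the apparent singularity of the scalar equation, so the system
  -- needs no pole there.
  refine ⟨!![coverPole m, 0;
    (1 - 2 * RatFunc.C m) / 6 * (RatFunc.C m ^ 3 -
      (3 * RatFunc.C m ^ 2 - 3 * RatFunc.C m + 1) * RatFunc.X),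
    -((1 - 2 * RatFunc.C m) * coverOne m / coverTriple m)],
    3 / 4 * ratDeriv (coverPole m) / coverPole m, ?_, ?_⟩
  · simp [Matrix.det_fin_two, h0, h1, h2, h3]
  · ext i j
    fin_cases i <;> fin_cases j
    · simp [Matrix.mul_apply, Fin.sum_univ_two, coeffMat_apply, ratFunc_C_ofNat]
      rw [ratDeriv_coverPole]
      field_simp
      simp only [coverPole]
      ring
    · simp [Matrix.mul_apply, Fin.sum_univ_two, coeffMat_apply, ratFunc_C_ofNat, hP]
      field_simp
      simp only [coverCritical]
      field_simp
      ring
    · simp [Matrix.mul_apply, Fin.sum_univ_two, coeffMat_apply, ratFunc_C_ofNat, hQ, ratDeriv_mul, ratDeriv_quot, ratDeriv_pow, ratDeriv_add]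
      rw [ratDeriv_coverPole]
      field_simp
      simp only [coverTriple, coverPole, coverCritical]
      ring
    · simp [Matrix.mul_apply, Fin.sum_univ_two, coeffMat_apply, ratFunc_C_ofNat, hP, hQ,
        ratDeriv_mul, ratDeriv_quot _ _ h3]
      rw [ratDeriv_coverPole, ratDeriv_coverOne, ratDeriv_coverTriple]
      field_simp
      simp only [coverTriple, coverPole, coverOne, coverCritical]
      ring

theorem isFuchsian_base : IsFuchsian !![1 / 48, -1 / 16; -7 / 16, -1 / 48]
    !![-3 / 16, 1 / 16; 7 / 16, 3 / 16] (1 / 3) (1 / 2) (1 / 3) := by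
  constructor
  · simp; norm_num
  · simp; norm_num
  · simp; norm_num
  · ext i j
    fin_cases i <;> fin_cases j <;> simp [sigma3] <;> norm_num

theorem projEquiv_base : ProjEquiv
    (coeffMat !![1 / 48, -1 / 16; -7 / 16, -1 / 48] !![-3 / 16, 1 / 16; 7 / 16, 3 / 16])
    (coeffMat !![0, 1; 0, 1 / 3] !![0, 0; 1 / 48, -1 / 2]) := by
  -- The columns of `K` are eigenvectors of the residue sum of the companion system; `k` and `l`
  -- remove the traces `1/3` and `-1/2` of its residues.
  refine projEquiv_of_const (K := !![1, 1; -1 / 4, 1 / 12]) (k := -1 / 6) (l := 1 / 4) ?_ ?_ ?_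
  · simp; norm_num
  · ext i j
    fin_cases i <;> fin_cases j <;> simp <;> norm_num
  · ext i j
    fin_cases i <;> fin_cases j <;> simp <;> norm_num

theorem exists_isFuchsian_projEquiv_pullback {m : ℂ} (hm : 1 - 2 * m ≠ 0) :
    ∃ B₀ B₁ : Matrix (Fin 2) (Fin 2) ℂ, IsFuchsian B₀ B₁ (1 / 3) (1 / 3) (-(1 / 3)) ∧
      ProjEquiv (pullback (tetrahedralCover m)
        (coeffMat !![1 / 48, -1 / 16; -7 / 16, -1 / 48] !![-3 / 16, 1 / 16; 7 / 16, 3 / 16]))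
        (coeffMat B₀ B₁) := by
  set B₀ : Matrix (Fin 2) (Fin 2) ℂ :=
    !![(2 - m) / 6 - (1 - 2 * m) / 12 - 1 / 6,
        m * (m - 2) / (1 - 2 * m) + 1 - (2 - m) + (1 - 2 * m) / 4;
      -(1 - 2 * m) / 36, (1 - 2 * m) / 12 + 1 / 6 - (2 - m) / 6] with hB
  refine ⟨B₀, (1 / 6 : ℂ) • sigma3 - B₀, ?_, ?_⟩
  · constructor
    · simp [hB]; ring
    · simp [hB]; field_simp; ring
    · simp [hB, sigma3]; field_simp; ring
    · ext i j
      fin_cases i <;> fin_cases j <;> simp [sigma3] <;> ring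
  · refine ((projEquiv_base.pullback _ (tetrahedralCover_not_const hm)).trans
      (projEquiv_pullback_tetrahedralCover hm)).trans ?_
    -- Both residues have trace `1/3`, whence `k = l = 1/6`; `K` diagonalizes the upper triangular
    -- residue sum.
    refine projEquiv_of_const (K := !![1, 3; 0, 1]) (k := 1 / 6) (l := 1 / 6) (by simp) ?_ ?_
    · ext i j
      fin_cases i <;> fin_cases j <;> simp [hB] <;> field_simp <;> ring
    · ext i j
      fin_cases i <;> fin_cases j <;> simp [hB, sigma3] <;> field_simp <;> ring

/-- The covering maps the systems of row 2 of the Schwarz list to the systems of row 3. -/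
theorem rsMaps_tetrahedralCover {m : ℂ} (hm : 1 - 2 * m ≠ 0) {θ θ' : Fin 3 → ℂ}
    {A₀ A₁ B₀ B₁ : Matrix (Fin 2) (Fin 2) ℂ} (hA : IsHypergeometric A₀ A₁ θ)
    (hθ : ShiftEquiv ![1 / 3, 1 / 2, 1 / 3] θ) (hB : IsHypergeometric B₀ B₁ θ')
    (hθ' : CorrespondsTo schwarzRow3 θ') :
    RSMaps (tetrahedralCover m) (coeffMat A₀ A₁) (coeffMat B₀ B₁) := by
  have hR := tetrahedralCover_not_const hm
  obtain ⟨D₀, D₁, hD, e⟩ := exists_isFuchsian_projEquiv_pullback hm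
  have e₁ := (hθ.projEquiv irredTriple_third_half_third isFuchsian_base hA.isFuchsian).symm
  have hD' : IsFuchsian (canonicalZero (1 / 3) (1 / 3) (1 / 3)) (canonicalOne (1 / 3) (1 / 3) (1 / 3))
      (1 / 3) (1 / 3) (1 / 3) := isFuchsian_canonical _ _ (by norm_num)
  have e₂ : ProjEquiv (coeffMat D₀ D₁) (canonicalMat (1 / 3) (1 / 3) (1 / 3)) :=
    (hD.projEquiv_canonical irredTriple_third.neg_right).trans
      (projEquiv_neg_right irredTriple_third).symm
  have e₃ := (shiftEquiv_of_correspondsTo_schwarzRow3 hθ').projEquiv irredTriple_third hD'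
    hB.isFuchsian
  exact RSMaps.of_projEquiv ((((e₁.pullback _ hR).trans e).trans e₂).trans e₃)
    hA.isFuchsian.trace_coeffMat hB.isFuchsian.trace_coeffMat hR

/-! ### Branching types from factorizations -/

theorem exists_num_denom_eq {R : RatFunc ℂ} {p q : ℂ[X]} (hpq : IsCoprime p q) (hq : q ≠ 0)
    (hR : R = algebraMap ℂ[X] (RatFunc ℂ) p / algebraMap ℂ[X] (RatFunc ℂ) q) :
    ∃ u : ℂ, u ≠ 0 ∧ R.num = C u * p ∧ R.denom = C u * q := by
  have h := (RatFunc.num_mul_eq_mul_denom_iff hq).mpr hR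
  have h1 : R.denom ∣ q :=
    R.isCoprime_num_denom.symm.dvd_of_dvd_mul_left ⟨p, by rw [h, mul_comm]⟩
  have h2 : q ∣ R.denom := hpq.symm.dvd_of_dvd_mul_left ⟨R.num, by rw [← h, mul_comm]⟩
  obtain ⟨v, hv⟩ := associated_of_dvd_dvd h2 h1
  obtain ⟨u, hu, huv⟩ := Polynomial.isUnit_iff.mp v.isUnit
  have hd : R.denom = C u * q := by rw [← hv, ← huv, mul_comm]
  refine ⟨u, hu.ne_zero, ?_, hd⟩
  rw [hd] at h
  exact mul_right_cancel₀ hq (by rw [h]; ring)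

/-- The degree missing from the fibre polynomial is the multiplicity of the point at infinity. -/
theorem fibreMultiplicities_eq {n : ℕ} {R : RatFunc ℂ} {w : OnePoint ℂ} {r : Fin n → ℂ}
    (hr : Function.Injective r) {e : Fin n → ℕ} (he : ∀ i, e i ≠ 0) {k : ℂ} (hk : k ≠ 0)
    (h : fibrePoly R w = C k * ∏ i, (X - C (r i)) ^ e i) :
    fibreMultiplicities R w = Finset.univ.val.map e +
      if ∑ i, e i < ratDegree R then {ratDegree R - ∑ i, e i} else 0 := by
  have hne : ∏ i, (X - C (r i)) ^ e i ≠ 0 :=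
    Finset.prod_ne_zero_iff.mpr fun i _ => pow_ne_zero _ (X_sub_C_ne_zero _)
  have hdeg : (fibrePoly R w).natDegree = ∑ i, e i := by
    rw [h, natDegree_C_mul hk, natDegree_prod _ _ fun i _ => pow_ne_zero _ (X_sub_C_ne_zero _)]
    simp
  have hcount : ∀ a, (fibrePoly R w).roots.count a = ∑ i, e i * if a = r i then 1 else 0 := by
    intro a
    rw [h, roots_C_mul _ hk, roots_prod _ _ hne, Multiset.count_bind]
    simp [Multiset.count_singleton, Finset.sum]
  have hroot : ∀ i, (fibrePoly R w).rootMultiplicity (r i) = e i := by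
    intro i
    rw [← count_roots, hcount, Finset.sum_eq_single i]
    · simp
    · intro j _ hj
      simp [hr.ne hj.symm]
    · simp
  have hdedup : (fibrePoly R w).roots.dedup = Finset.univ.val.map r := by
    refine (Multiset.Nodup.ext (Multiset.nodup_dedup _) (Finset.univ.nodup.map hr)).mpr fun a => ?_
    rw [Multiset.mem_dedup, ← Multiset.count_pos, hcount, Finset.sum_pos_iff]
    simp only [Multiset.mem_map, Finset.mem_val, Finset.mem_univ, true_and]
    constructor
    · rintro ⟨i, hi⟩
      refine ⟨i, ?_⟩
      by_contra hne
      simp [Ne.symm hne] at hi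
    · rintro ⟨i, rfl⟩
      exact ⟨i, by simpa using Nat.pos_of_ne_zero (he i)⟩
  rw [fibreMultiplicities, hdeg, hdedup, Multiset.map_map]
  simp [hroot]

/-- The type of a rational function with three zeros, two triple poles, and three double points
over `1`. -/
theorem hasType_of_factorization {R : RatFunc ℂ} {z g : Fin 3 → ℂ} {c : Fin 2 → ℂ}
    (hz : Function.Injective z) (hg : Function.Injective g) (hc : Function.Injective c)
    (hzc : ∀ i j, z i ≠ c j) {e : Fin 3 → ℕ} (he : ∀ i, e i ≠ 0) (he6 : ∑ i, e i < 6) {k : ℂ}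
    (hk : k ≠ 0)
    (hR : R = algebraMap ℂ[X] (RatFunc ℂ) (C k * ∏ i, (X - C (z i)) ^ e i) /
      algebraMap ℂ[X] (RatFunc ℂ) (∏ j, (X - C (c j)) ^ 3))
    (hone : C k * ∏ i, (X - C (z i)) ^ e i - ∏ j, (X - C (c j)) ^ 3 =
      -∏ i, (X - C (g i)) ^ 2) :
    HasType R (Finset.univ.val.map e + {6 - ∑ i, e i}) {2, 2, 2} {3, 3} := by
  have hq : ∏ j, (X - C (c j)) ^ 3 ≠ 0 :=
    Finset.prod_ne_zero_iff.mpr fun i _ => pow_ne_zero _ (X_sub_C_ne_zero _)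
  have hpq : IsCoprime (C k * ∏ i, (X - C (z i)) ^ e i) (∏ j, (X - C (c j)) ^ 3) := by
    refine (isCoprime_mul_unit_left_left (isUnit_C.mpr hk.isUnit) _ _).mpr ?_
    refine IsCoprime.prod_left fun i _ => IsCoprime.prod_right fun j _ => IsCoprime.pow ?_
    exact isCoprime_X_sub_C_of_isUnit_sub (sub_ne_zero.mpr (hzc i j)).isUnit
  obtain ⟨u, hu, hnum, hden⟩ := exists_num_denom_eq hpq hq hR
  have hdp : (C k * ∏ i, (X - C (z i)) ^ e i).natDegree = ∑ i, e i := by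
    rw [natDegree_C_mul hk, natDegree_prod _ _ fun i _ => pow_ne_zero _ (X_sub_C_ne_zero _)]
    simp
  have hdq : (∏ j, (X - C (c j)) ^ 3).natDegree = 6 := by
    rw [natDegree_prod _ _ fun i _ => pow_ne_zero _ (X_sub_C_ne_zero _)]
    simp
  have hdeg : ratDegree R = 6 := by
    rw [ratDegree, hnum, hden, natDegree_C_mul hu, natDegree_C_mul hu, hdp, hdq]
    exact max_eq_right he6.le
  refine ⟨?_, ?_, ?_⟩
  · rw [fibreMultiplicities_eq hz he (mul_ne_zero hu hk), hdeg, if_pos he6]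
    change R.num - C 0 * R.denom = _
    rw [hnum, C_0, zero_mul, sub_zero, C_mul, mul_assoc]
  · rw [fibreMultiplicities_eq hg (e := fun _ => 2) (fun _ => two_ne_zero) (neg_ne_zero.mpr hu),
      hdeg]
    · rfl
    · change R.num - C 1 * R.denom = _
      rw [hnum, hden, C_1, one_mul, ← mul_sub, hone, C_neg, mul_neg, neg_mul]
  · rw [fibreMultiplicities_eq hc (e := fun _ => 3) (fun _ => three_ne_zero) hu, hdeg]
    · rfl
    · exact hden

theorem exists_quadratic_roots {a b : ℂ} (h : a ^ 2 - 4 * b ≠ 0) :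
    ∃ c : Fin 2 → ℂ, Function.Injective c ∧ c 0 + c 1 = a ∧ c 0 * c 1 = b := by
  obtain ⟨w, hw⟩ := IsAlgClosed.exists_pow_nat_eq (a ^ 2 - 4 * b) two_pos
  have hw0 : w ≠ 0 := by
    rintro rfl
    exact h (by rw [← hw]; ring)
  refine ⟨![(a + w) / 2, (a - w) / 2], ?_, ?_, ?_⟩
  · have : (a + w) / 2 ≠ (a - w) / 2 := fun e => hw0 (by linear_combination e)
    intro i j hij
    fin_cases i <;> fin_cases j <;> simp_all
  · simp; ring
  · simp; linear_combination -(1 / 4) * hw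

theorem exists_cubic_roots {b c d : ℂ}
    (h : b ^ 2 * c ^ 2 - 4 * c ^ 3 - 4 * b ^ 3 * d - 27 * d ^ 2 + 18 * b * c * d ≠ 0) :
    ∃ g : Fin 3 → ℂ, Function.Injective g ∧
      (X ^ 3 + C b * X ^ 2 + C c * X + C d : ℂ[X]) = ∏ i, (X - C (g i)) := by
  set P : Cubic ℂ := ⟨1, b, c, d⟩ with hP
  have ha : P.a ≠ 0 := one_ne_zero
  have hs : (P.toPoly.map (RingHom.id ℂ)).Splits := IsAlgClosed.splits _
  obtain ⟨x, y, z, h3⟩ := (Cubic.splits_iff_roots_eq_three ha).mp hs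
  have hd : P.discr ≠ 0 := by
    simpa [Cubic.discr, hP] using h
  obtain ⟨hxy, hxz, hyz⟩ := (Cubic.discr_ne_zero_iff_roots_ne ha h3).mp hd
  have hprod := Cubic.eq_prod_three_roots ha h3
  refine ⟨![x, y, z], ?_, ?_⟩
  · intro i j hij
    fin_cases i <;> fin_cases j <;> simp_all
  · rw [Fin.prod_univ_three]
    simpa [Cubic.map, Cubic.toPoly, hP] using hprod

theorem quadratic_eq_mul {c : Fin 2 → ℂ} {a b : ℂ} (ha : c 0 + c 1 = a) (hb : c 0 * c 1 = b) :
    (X - C (c 0)) * (X - C (c 1)) = X ^ 2 - C a * X + C b := by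
  rw [← ha, ← hb, C_add, C_mul]
  ring

theorem injective_vec_three {x y z : ℂ} (hxy : x ≠ y) (hxz : x ≠ z) (hyz : y ≠ z) :
    Function.Injective ![x, y, z] := by
  intro i j hij
  fin_cases i <;> fin_cases j <;> simp_all

theorem hasType_tetrahedralCover {m : ℂ} (h0 : m ≠ 0) (hd : 1 - 2 * m ≠ 0) (h1 : 1 - m ≠ 0)
    (h2 : 2 - m ≠ 0) (h3 : 1 + m ≠ 0) (hq : m ^ 2 - m + 1 ≠ 0)
    (hr : (2 - m) ^ 6 - 6 * (2 - m) ^ 4 * (m ^ 2 - m + 1) +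
      9 * (2 - m) ^ 2 * (m ^ 2 - m + 1) ^ 2 - 8 * (m ^ 2 - m + 1) ^ 3 ≠ 0) :
    HasType (tetrahedralCover m) {3, 1, 1, 1} {2, 2, 2} {3, 3} := by
  set a : ℂ := m ^ 3 * (m - 2) / (1 - 2 * m) with ha
  have ha' : (1 - 2 * m) * a = m ^ 3 * (m - 2) := by rw [ha]; field_simp
  have hm2 : m - 2 ≠ 0 := by rw [← neg_sub]; exact neg_ne_zero.mpr h2
  have ha0 : a ≠ 0 := div_ne_zero (mul_ne_zero (pow_ne_zero 3 h0) hm2) hd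
  have ha1 : a ≠ 1 := by
    intro h
    rw [h] at ha'
    have : (1 - m) ^ 3 * (1 + m) = 0 := by linear_combination ha'
    exact mul_ne_zero (pow_ne_zero 3 h1) h3 this
  obtain ⟨c, hc, hcs, hcp⟩ := exists_quadratic_roots (a := 2 * m * (2 * m ^ 2 - 3 * m + 2))
    (b := m ^ 4) (by
      have : (2 * m * (2 * m ^ 2 - 3 * m + 2)) ^ 2 - 4 * m ^ 4 =
        16 * m ^ 2 * (1 - m) ^ 2 * (m ^ 2 - m + 1) := by ring
      rw [this]
      exact mul_ne_zero (mul_ne_zero (mul_ne_zero (by norm_num) (pow_ne_zero 2 h0))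
        (pow_ne_zero 2 h1)) hq)
  obtain ⟨g, hg, hgp⟩ := exists_cubic_roots (b := 10 * m ^ 3 - 15 * m ^ 2 + 6 * m - 2)
    (c := -(m ^ 3 * (2 * m ^ 3 - 6 * m ^ 2 + 15 * m - 10))) (d := m ^ 6) (by
      -- The discriminant of the cubic is `-108 m⁶ (1 - m)⁶` times the expression in `hr`.
      have := mul_ne_zero (mul_ne_zero (pow_ne_zero 6 h0) (pow_ne_zero 6 h1)) hr
      intro h
      apply this
      linear_combination -(1 / 108) * h)
  have hcq := quadratic_eq_mul hcs hcp
  have hev : ∀ x, (∃ j, x = c j) → x ^ 2 - 2 * m * (2 * m ^ 2 - 3 * m + 2) * x + m ^ 4 = 0 := by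
    rintro x ⟨j, rfl⟩
    rw [← hcs, ← hcp]
    fin_cases j <;> simp <;> ring
  have hz := injective_vec_three zero_ne_one ha0.symm ha1.symm
  have key := hasType_of_factorization (R := tetrahedralCover m) (z := ![0, 1, a]) (g := g) (c := c)
    hz hg hc ?_ (e := ![1, 1, 3]) ?_ (by decide) (k := 4 * (1 - 2 * m) ^ 3)
    (mul_ne_zero (by norm_num) (pow_ne_zero 3 hd)) ?_ ?_
  · have e : Finset.univ.val.map ![1, 1, 3] + {6 - ∑ i, (![1, 1, 3] : Fin 3 → ℕ) i} =
        ({3, 1, 1, 1} : Multiset ℕ) := by decide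
    rwa [e] at key
  · intro i j hij
    have := hev _ ⟨j, hij⟩
    fin_cases i
    · simp [h0] at this
    · have e : (1 - m) ^ 4 = 0 := by
        simp at this
        linear_combination this
      exact pow_ne_zero 4 h1 e
    · have e : 9 * m ^ 4 * (1 - m) ^ 4 = 0 := by
        simp at this
        linear_combination (1 - 2 * m) ^ 2 * this - ((1 - 2 * m) * a + m ^ 3 * (m - 2) -
          2 * m * (2 * m ^ 2 - 3 * m + 2) * (1 - 2 * m)) * ha'
      exact mul_ne_zero (mul_ne_zero (by norm_num) (pow_ne_zero 4 h0)) (pow_ne_zero 4 h1) e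
  · intro i
    fin_cases i <;> simp
  · rw [Fin.prod_univ_three, Fin.prod_univ_two, ← mul_pow, hcq, tetrahedralCover]
    have e := congrArg (RatFunc.C (K := ℂ)) ha'
    simp only [map_mul, map_sub, map_one, map_pow, ratFunc_C_ofNat] at e
    simp only [Matrix.cons_val, map_mul, map_sub, map_add, map_pow, map_one, RatFunc.algebraMap_C,
      RatFunc.algebraMap_X, ratFunc_C_ofNat, map_zero, sub_zero, pow_one]
    rw [← e]
    ring
  · rw [Fin.prod_univ_three, Fin.prod_univ_two, ← mul_pow, hcq, Finset.prod_pow, ← hgp]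
    have e := congrArg (C (R := ℂ)) ha'
    simp only [map_mul, map_sub, map_one, map_pow, map_ofNat] at e
    have e' : (C (4 * (1 - 2 * m) ^ 3) : ℂ[X]) * ((X - C 0) ^ 1 * (X - C 1) ^ 1 * (X - C a) ^ 3) =
        4 * (X * (X - 1) * ((1 - 2 * C m) * X - C m ^ 3 * (C m - 2)) ^ 3) := by
      rw [← e]
      simp only [map_mul, map_sub, map_one, map_pow, map_ofNat, map_zero]
      ring
    simp only [Matrix.cons_val]
    rw [e']
    simp only [map_mul, map_sub, map_add, map_neg, map_pow, map_ofNat]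
    ring

/-! ### Reduction of the family to the parameter m -/

/-- The parameter on which all quantities of the family depend. -/
noncomputable def coverParam (s : ℂ) : ℂ :=
  (s + 1) * (7 * s + 1) / ((4 * s + 1) * (10 * s + 1))

theorem coverParam_mul {s : ℂ} (h4 : 4 * s + 1 ≠ 0) (h10 : 10 * s + 1 ≠ 0) :
    coverParam s * ((4 * s + 1) * (10 * s + 1)) = (s + 1) * (7 * s + 1) :=
  div_mul_cancel₀ _ (mul_ne_zero h4 h10)

theorem one_add_coverParam {s : ℂ} (h4 : 4 * s + 1 ≠ 0) (h10 : 10 * s + 1 ≠ 0) :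
    1 + coverParam s = p₃ s / ((4 * s + 1) * (10 * s + 1)) := by
  rw [eq_div_iff (mul_ne_zero h4 h10), p₃]
  linear_combination coverParam_mul h4 h10

theorem one_sub_coverParam {s : ℂ} (h4 : 4 * s + 1 ≠ 0) (h10 : 10 * s + 1 ≠ 0) :
    1 - coverParam s = 3 * s * (11 * s + 2) / ((4 * s + 1) * (10 * s + 1)) := by
  rw [eq_div_iff (mul_ne_zero h4 h10)]
  linear_combination -coverParam_mul h4 h10

theorem two_sub_coverParam {s : ℂ} (h4 : 4 * s + 1 ≠ 0) (h10 : 10 * s + 1 ≠ 0) :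
    2 - coverParam s = p₁ s / ((4 * s + 1) * (10 * s + 1)) := by
  rw [eq_div_iff (mul_ne_zero h4 h10), p₁]
  linear_combination -coverParam_mul h4 h10

theorem one_sub_two_mul_coverParam {s : ℂ} (h4 : 4 * s + 1 ≠ 0) (h10 : 10 * s + 1 ≠ 0) :
    1 - 2 * coverParam s = (p₁ s - p₃ s) / ((4 * s + 1) * (10 * s + 1)) := by
  rw [eq_div_iff (mul_ne_zero h4 h10), p₁, p₃]
  linear_combination -2 * coverParam_mul h4 h10

/-- This explains the choice of `s`: it makes `m ^ 2 - m + 1` a square, so that the two poles of the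
covering, which involve its square root, are rational in `s`. -/
theorem coverParam_sq_sub {s : ℂ} (h4 : 4 * s + 1 ≠ 0) (h10 : 10 * s + 1 ≠ 0) :
    coverParam s ^ 2 - coverParam s + 1 = (p₂ s / ((4 * s + 1) * (10 * s + 1))) ^ 2 := by
  rw [div_pow, eq_div_iff (pow_ne_zero 2 (mul_ne_zero h4 h10)), p₂]
  linear_combination (coverParam s * ((4 * s + 1) * (10 * s + 1)) + (s + 1) * (7 * s + 1) -
    (4 * s + 1) * (10 * s + 1)) * coverParam_mul h4 h10

/-- No value of the parameter at which points of the fibres coalesce is attained. -/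
theorem Admissible.coverParam_ne_zero {s : ℂ} (hs : Admissible s) :
    coverParam s ≠ 0 ∧ 1 - 2 * coverParam s ≠ 0 ∧ 1 - coverParam s ≠ 0 ∧ 2 - coverParam s ≠ 0 ∧
      1 + coverParam s ≠ 0 ∧ coverParam s ^ 2 - coverParam s + 1 ≠ 0 ∧
      (2 - coverParam s) ^ 6 - 6 * (2 - coverParam s) ^ 4 * (coverParam s ^ 2 - coverParam s + 1) +
        9 * (2 - coverParam s) ^ 2 * (coverParam s ^ 2 - coverParam s + 1) ^ 2 -
        8 * (coverParam s ^ 2 - coverParam s + 1) ^ 3 ≠ 0 := by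
  obtain ⟨h4, h10, h0, h11, h1, h7, hp1, hp2, hp3, hp13, hr⟩ := hs
  have hw : (4 * s + 1) * (10 * s + 1) ≠ 0 := mul_ne_zero h4 h10
  refine ⟨div_ne_zero (mul_ne_zero h1 h7) hw, ?_, ?_, ?_, ?_, ?_, ?_⟩
  · rw [one_sub_two_mul_coverParam h4 h10]
    exact div_ne_zero hp13 hw
  · rw [one_sub_coverParam h4 h10]
    exact div_ne_zero (mul_ne_zero (mul_ne_zero three_ne_zero h0) h11) hw
  · rw [two_sub_coverParam h4 h10]
    exact div_ne_zero hp1 hw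
  · rw [one_add_coverParam h4 h10]
    exact div_ne_zero hp3 hw
  · rw [coverParam_sq_sub h4 h10]
    exact pow_ne_zero 2 (div_ne_zero hp2 hw)
  · rw [coverParam_sq_sub h4 h10, two_sub_coverParam h4 h10]
    convert div_ne_zero hr (pow_ne_zero 6 hw) using 1
    generalize (4 * s + 1) * (10 * s + 1) = w
    ring

theorem b₀_eq {s : ℂ} (h4 : 4 * s + 1 ≠ 0) (h10 : 10 * s + 1 ≠ 0) :
    b₀ s = (1 - coverParam s) ^ 3 * (1 + coverParam s) ^ 3 / 27 := by
  rw [b₀, one_add_coverParam h4 h10, one_sub_coverParam h4 h10]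
  generalize p₃ s = v
  field_simp
  norm_num

theorem b₁_eq {s : ℂ} (h4 : 4 * s + 1 ≠ 0) (h10 : 10 * s + 1 ≠ 0) :
    b₁ s = (1 + coverParam s) ^ 2 *
      ((2 - coverParam s) ^ 4 + (coverParam s ^ 2 - coverParam s + 1) ^ 2) / 27 := by
  rw [b₁, one_add_coverParam h4 h10, two_sub_coverParam h4 h10, coverParam_sq_sub h4 h10]
  generalize p₁ s = u
  generalize p₂ s = v
  generalize p₃ s = w
  field_simp
  norm_num

theorem b₂_eq {s : ℂ} (h4 : 4 * s + 1 ≠ 0) (h10 : 10 * s + 1 ≠ 0) :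
    b₂ s = -((1 + coverParam s) *
      ((2 - coverParam s) ^ 2 + (coverParam s ^ 2 - coverParam s + 1)) / 3) := by
  rw [b₂, one_add_coverParam h4 h10, two_sub_coverParam h4 h10, coverParam_sq_sub h4 h10]
  generalize p₁ s = u
  generalize p₂ s = v
  generalize p₃ s = w
  field_simp

/-- Separately `c₁` and `c₂` need the square root of `m ^ 2 - m + 1`, but their sum and product are
polynomials in `m`. -/
theorem c₁_add_c₂_eq {s : ℂ} (h4 : 4 * s + 1 ≠ 0) (h10 : 10 * s + 1 ≠ 0) :
    c₁ s + c₂ s =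
      2 * (1 + coverParam s) * (2 * coverParam s ^ 2 - 5 * coverParam s + 5) / 9 := by
  have e : 2 * coverParam s ^ 2 - 5 * coverParam s + 5 =
      (2 - coverParam s) ^ 2 + (coverParam s ^ 2 - coverParam s + 1) := by ring
  rw [c₁, c₂, e, one_add_coverParam h4 h10, two_sub_coverParam h4 h10, coverParam_sq_sub h4 h10,
    p₁, p₂]
  generalize p₃ s = v
  field_simp
  ring

theorem c₁_mul_c₂_eq {s : ℂ} (h4 : 4 * s + 1 ≠ 0) (h10 : 10 * s + 1 ≠ 0) :
    c₁ s * c₂ s = (1 + coverParam s) ^ 2 * (1 - coverParam s) ^ 2 / 9 := by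
  rw [c₁, c₂, one_add_coverParam h4 h10, one_sub_coverParam h4 h10]
  generalize p₃ s = v
  field_simp
  norm_num

theorem tPt_eq {s : ℂ} (hs : Admissible s) :
    tPt s = (1 - coverParam s) ^ 3 * (1 + coverParam s) / (1 - 2 * coverParam s) := by
  obtain ⟨h4, h10, -, -, -, -, -, -, -, hp13, -⟩ := hs
  rw [tPt, one_add_coverParam h4 h10, one_sub_coverParam h4 h10,
    one_sub_two_mul_coverParam h4 h10]
  generalize p₁ s - p₃ s = u at *
  generalize p₃ s = v
  field_simp

theorem Admissible.tPt_ne {s : ℂ} (hs : Admissible s) : tPt s ≠ 0 ∧ tPt s ≠ 1 := by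
  obtain ⟨m0, md, m1, m2, m3, -⟩ := hs.coverParam_ne_zero
  rw [tPt_eq hs]
  refine ⟨div_ne_zero (mul_ne_zero (pow_ne_zero 3 m1) m3) md, fun h => ?_⟩
  rw [div_eq_one_iff_eq md] at h
  exact mul_ne_zero (pow_ne_zero 3 m0) m2 (by linear_combination h)

theorem kappa_eq {s : ℂ} (h4 : 4 * s + 1 ≠ 0) (h10 : 10 * s + 1 ≠ 0) :
    kappa s = -(4 * (1 - 2 * coverParam s) * (2 - coverParam s) ^ 4 * (1 + coverParam s) ^ 4 /
      729) := by
  rw [kappa, one_add_coverParam h4 h10, two_sub_coverParam h4 h10,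
    one_sub_two_mul_coverParam h4 h10]
  generalize p₁ s - p₃ s = u
  generalize p₁ s = v
  generalize p₃ s = w
  field_simp
  norm_num

theorem rPart_polynomial_identity {s : ℂ} (hs : Admissible s) :
    C (kappa s) * (X * (X - 1) * (X - C (tPt s))) - ((X - C (c₁ s)) * (X - C (c₂ s))) ^ 3 =
      -(X ^ 3 + C (b₂ s) * X ^ 2 + C (b₁ s) * X + C (b₀ s) : ℂ[X]) ^ 2 := by
  have ht := tPt_eq hs
  have hd := hs.coverParam_ne_zero.2.1
  obtain ⟨h4, h10, -⟩ := hs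
  refine Polynomial.funext fun x => ?_
  have hc : (x - c₁ s) * (x - c₂ s) = x ^ 2 - (c₁ s + c₂ s) * x + c₁ s * c₂ s := by ring
  simp only [eval_sub, eval_mul, eval_pow, eval_neg, eval_add, eval_C, eval_X, eval_one]
  rw [hc, c₁_add_c₂_eq h4 h10, c₁_mul_c₂_eq h4 h10, b₀_eq h4 h10, b₁_eq h4 h10, b₂_eq h4 h10, ht,
    kappa_eq h4 h10]
  field_simp
  ring

theorem hasType_rPart {s : ℂ} (hs : Admissible s) :
    HasType (rPart s) {3, 1, 1, 1} {2, 2, 2} {3, 3} := by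
  obtain ⟨m0, md, m1, m2, m3, mq, mr⟩ := hs.coverParam_ne_zero
  have hid := rPart_polynomial_identity hs
  have ht := tPt_eq hs
  obtain ⟨ht0, ht1⟩ := hs.tPt_ne
  obtain ⟨h4, h10, -⟩ := hs
  have hS := c₁_add_c₂_eq h4 h10
  have hP := c₁_mul_c₂_eq h4 h10
  have hk := kappa_eq h4 h10
  obtain ⟨g, hg, hgp⟩ := exists_cubic_roots (b := b₂ s) (c := b₁ s) (d := b₀ s) (by
    rw [b₀_eq h4 h10, b₁_eq h4 h10, b₂_eq h4 h10]
    -- This product is the discriminant of the cubic over `1`.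
    have := mul_ne_zero (mul_ne_zero (mul_ne_zero (pow_ne_zero 6 m3) (pow_ne_zero 6 m2)) mr)
      (by norm_num : (-4 / 19683 : ℂ) ≠ 0)
    intro h
    apply this
    rw [← h]
    ring)
  generalize coverParam s = m at *
  have ht' : (1 - 2 * m) * tPt s = (1 - m) ^ 3 * (1 + m) := by rw [ht]; field_simp
  have hc : c₁ s ≠ c₂ s := by
    intro h
    have : 16 * ((1 + m) ^ 2 * (2 - m) ^ 2 * (m ^ 2 - m + 1)) = 0 := by
      have e : (c₁ s + c₂ s) ^ 2 - 4 * (c₁ s * c₂ s) = 0 := by rw [h]; ring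
      rw [hS, hP] at e
      linear_combination 81 * e
    exact mul_ne_zero (by norm_num)
      (mul_ne_zero (mul_ne_zero (pow_ne_zero 2 m3) (pow_ne_zero 2 m2)) mq) this
  have hk0 : kappa s ≠ 0 := by
    rw [hk]
    exact neg_ne_zero.mpr (div_ne_zero (mul_ne_zero (mul_ne_zero (mul_ne_zero (by norm_num) md)
      (pow_ne_zero 4 m2)) (pow_ne_zero 4 m3)) (by norm_num))
  have hev : ∀ x, (∃ j, x = ![c₁ s, c₂ s] j) →
      9 * x ^ 2 - 2 * (1 + m) * (2 * m ^ 2 - 5 * m + 5) * x + (1 + m) ^ 2 * (1 - m) ^ 2 = 0 := by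
    rintro x ⟨j, rfl⟩
    fin_cases j <;> simp <;> [linear_combination 9 * c₁ s * hS - 9 * hP;
      linear_combination 9 * c₂ s * hS - 9 * hP]
  have hcinj : Function.Injective ![c₁ s, c₂ s] := by
    intro i j hij
    fin_cases i <;> fin_cases j <;> simp_all
  have key := hasType_of_factorization (R := rPart s) (z := ![0, 1, tPt s]) (g := g)
    (c := ![c₁ s, c₂ s]) (injective_vec_three zero_ne_one ht0.symm ht1.symm) hg hcinj ?_
    (e := fun _ => 1) (fun _ => one_ne_zero) (by decide) hk0 ?_ ?_
  · have e : Finset.univ.val.map (fun _ : Fin 3 => 1) + {6 - ∑ _i : Fin 3, 1} =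
        ({3, 1, 1, 1} : Multiset ℕ) := by decide
    rwa [e] at key
  · intro i j hij
    have := hev _ ⟨j, hij⟩
    fin_cases i
    · simp [m1, m3] at this
    · have e : m ^ 2 * (2 - m) ^ 2 = 0 := by
        simp at this
        linear_combination this
      exact mul_ne_zero (pow_ne_zero 2 m0) (pow_ne_zero 2 m2) e
    · have e : m ^ 2 * (1 - m) ^ 2 * (1 + m) ^ 2 * (2 - m) ^ 2 = 0 := by
        simp at this
        linear_combination (1 - 2 * m) ^ 2 * this - (9 * ((1 - 2 * m) * tPt s +
          (1 - m) ^ 3 * (1 + m)) - 2 * (1 + m) * (2 * m ^ 2 - 5 * m + 5) * (1 - 2 * m)) * ht'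
      exact mul_ne_zero (mul_ne_zero (mul_ne_zero (pow_ne_zero 2 m0) (pow_ne_zero 2 m1))
        (pow_ne_zero 2 m3)) (pow_ne_zero 2 m2) e
  · rw [Fin.prod_univ_three, Fin.prod_univ_two, rPart]
    simp only [Matrix.cons_val, map_mul, map_sub, map_pow, map_one, RatFunc.algebraMap_C,
      RatFunc.algebraMap_X, map_zero, sub_zero, pow_one]
    ring
  · rw [Fin.prod_univ_three, Fin.prod_univ_two, ← mul_pow, Finset.prod_pow, ← hgp, ← hid]
    simp only [Matrix.cons_val, C_0, C_1, sub_zero, pow_one, mul_pow]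

theorem rPart_sub_one {s : ℂ} (hs : Admissible s) :
    rPart s - 1 =
      -((RatFunc.X ^ 3 + RatFunc.C (b₂ s) * RatFunc.X ^ 2 + RatFunc.C (b₁ s) * RatFunc.X +
            RatFunc.C (b₀ s)) ^ 2 /
          ((RatFunc.X - RatFunc.C (c₁ s)) ^ 3 * (RatFunc.X - RatFunc.C (c₂ s)) ^ 3)) := by
  have h := congrArg (algebraMap ℂ[X] (RatFunc ℂ)) (rPart_polynomial_identity hs)
  simp only [map_mul, map_sub, map_add, map_neg, map_pow, map_one, RatFunc.algebraMap_C,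
    RatFunc.algebraMap_X] at h
  have h1 := ratFunc_X_sub_C_ne_zero (c₁ s)
  have h2 := ratFunc_X_sub_C_ne_zero (c₂ s)
  have h3 := mul_ne_zero (pow_ne_zero 3 h1) (pow_ne_zero 3 h2)
  rw [rPart, mul_div_assoc', div_sub_one h3, ← neg_div, ← h, mul_pow]

theorem moebiusInv_not_const {t : ℂ} (h0 : t ≠ 0) (h1 : t ≠ 1) :
    ¬∃ c, moebiusInv t = RatFunc.C c := by
  rintro ⟨c, hc⟩
  have h := ratFunc_X_sub_C_ne_zero (1 - t)
  rw [moebiusInv, div_eq_iff h] at hc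
  have h' := congrArg ratDeriv hc
  simp only [ratDeriv_mul, ratDeriv_sub, ratDeriv_X, ratDeriv_C, mul_zero, add_zero, sub_zero,
    mul_one] at h'
  rw [← h'] at hc
  have : RatFunc.C (t * (1 - t)) = 0 := by
    rw [map_mul]
    linear_combination hc
  exact mul_ne_zero h0 (sub_ne_zero.mpr h1.symm) (ratFunc_C_eq_zero.mp this)

/-- The substitution turns each factor of `rPart s` into a constant times a factor of the covering
over a power of `coverTriple m`. The pole `1 - t` of `moebiusInv t` is the root of `coverTriple m`:
the triple zero moves there from infinity. -/
theorem normalizedRPart_eq {s : ℂ} (hs : Admissible s) :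
    normalizedRPart s = tetrahedralCover (coverParam s) := by
  obtain ⟨m0, md, m1, m2, m3, mq, mr⟩ := hs.coverParam_ne_zero
  have ht := tPt_eq hs
  obtain ⟨ht0, ht1⟩ := hs.tPt_ne
  obtain ⟨h4, h10, -⟩ := hs
  have hS := c₁_add_c₂_eq h4 h10
  have hP := c₁_mul_c₂_eq h4 h10
  have hk := kappa_eq h4 h10
  generalize coverParam s = m at *
  have hg := moebiusInv_not_const ht0 ht1
  have hne : ∀ a : ℂ, a ≠ 0 → RatFunc.C a ≠ 0 := fun a ha => mt ratFunc_C_eq_zero.mp ha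
  have n0 := hne _ m0
  have nd := hne _ md
  have n1 := hne _ m1
  have n2 := hne _ m2
  have n3 := hne _ m3
  have hS' := congrArg (RatFunc.C (K := ℂ)) hS
  have hP' := congrArg (RatFunc.C (K := ℂ)) hP
  have hk' := congrArg (RatFunc.C (K := ℂ)) hk
  have hT := congrArg (RatFunc.C (K := ℂ)) ht
  simp only [map_mul, map_sub, map_add, map_neg, map_pow, map_one, map_div₀, ratFunc_C_ofNat]
    at nd n1 n2 n3 hS' hP' hk' hT
  have hL := coverTriple_ne_zero md
  have hH := coverPole_ne_zero m
  have hden := ratFunc_X_sub_C_ne_zero (1 - tPt s)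
  have hgX : moebiusInv (tPt s) =
      (1 - RatFunc.C m) ^ 3 * (1 + RatFunc.C m) * RatFunc.X / coverTriple m := by
    have e := (eq_div_iff nd).mp hT
    rw [moebiusInv, div_eq_div_iff hden hL, map_sub, map_one, coverTriple]
    linear_combination RatFunc.X * (RatFunc.X - 1) * e
  have hg1 : moebiusInv (tPt s) - 1 =
      RatFunc.C m ^ 3 * (2 - RatFunc.C m) * (RatFunc.X - 1) / coverTriple m := by
    rw [hgX, div_sub_one hL]
    congr 1
    rw [coverTriple]
    ring
  have hgt : moebiusInv (tPt s) - RatFunc.C (tPt s) =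
      -((1 - RatFunc.C m) ^ 3 * (1 + RatFunc.C m) * (RatFunc.C m ^ 3 * (2 - RatFunc.C m)) /
        ((1 - 2 * RatFunc.C m) * coverTriple m)) := by
    rw [hgX, hT, div_sub_div _ _ hL nd, ← neg_div]
    congr 1
    · rw [coverTriple]
      ring
    · ring
  have hgc : (moebiusInv (tPt s) - RatFunc.C (c₁ s)) * (moebiusInv (tPt s) - RatFunc.C (c₂ s)) =
      (1 + RatFunc.C m) ^ 2 * (1 - RatFunc.C m) ^ 2 * RatFunc.C m ^ 2 * (2 - RatFunc.C m) ^ 2 *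
        coverPole m / (9 * coverTriple m ^ 2) := by
    have : (moebiusInv (tPt s) - RatFunc.C (c₁ s)) * (moebiusInv (tPt s) - RatFunc.C (c₂ s)) =
        moebiusInv (tPt s) ^ 2 - (RatFunc.C (c₁ s) + RatFunc.C (c₂ s)) * moebiusInv (tPt s) +
          RatFunc.C (c₁ s) * RatFunc.C (c₂ s) := by ring
    rw [this, hS', hP', hgX]
    field_simp
    rw [coverTriple, coverPole]
    ring
  rw [normalizedRPart, ← compHom_apply _ hg, rPart, ← mul_pow]
  simp only [map_mul, map_sub, map_pow, map_one, map_div₀, compHom_C, compHom_X]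
  rw [hg1, hgt, hgc, hgX, hk', tetrahedralCover_eq]
  field_simp
  ring

end RSTransformation

theorem proposition4 (s : ℂ) (hs : Admissible s) :
    HasType (rPart s) {3, 1, 1, 1} {2, 2, 2} {3, 3} ∧
    rPart s - 1 =
      -((RatFunc.X ^ 3 + RatFunc.C (b₂ s) * RatFunc.X ^ 2 + RatFunc.C (b₁ s) * RatFunc.X +
            RatFunc.C (b₀ s)) ^ 2 /
          ((RatFunc.X - RatFunc.C (c₁ s)) ^ 3 * (RatFunc.X - RatFunc.C (c₂ s)) ^ 3)) ∧
    HasType (normalizedRPart s) {3, 1, 1, 1} {2, 2, 2} {3, 3} ∧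
    ∀ (θ : Fin 3 → ℂ) (A₀ A₁ : Matrix (Fin 2) (Fin 2) ℂ),
      IsHypergeometric A₀ A₁ θ → ShiftEquiv ![1 / 3, 1 / 2, 1 / 3] θ →
        CorrespondsTo schwarzRow2 θ ∧
        ∀ (θ' : Fin 3 → ℂ) (B₀ B₁ : Matrix (Fin 2) (Fin 2) ℂ),
          IsHypergeometric B₀ B₁ θ' → CorrespondsTo schwarzRow3 θ' →
            RSMaps (normalizedRPart s) (coeffMat A₀ A₁) (coeffMat B₀ B₁) := by
  obtain ⟨m0, md, m1, m2, m3, mq, mr⟩ := hs.coverParam_ne_zero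
  refine ⟨hasType_rPart hs, rPart_sub_one hs, ?_, fun θ A₀ A₁ hA hθ =>
    ⟨correspondsTo_schwarzRow2 hθ, fun θ' B₀ B₁ hB hθ' => ?_⟩⟩
  · rw [normalizedRPart_eq hs]
    exact hasType_tetrahedralCover m0 md m1 m2 m3 mq mr
  · rw [normalizedRPart_eq hs]
    exact rsMaps_tetrahedralCover md hA hθ hB hθ'
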